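/- Let $\tau\ge 2$ be an integer, $\sigma>0$, $q\ge 0$ and let $\mathcal{CN}(0,S)$ denote the circularly symmetric complex Gaussian law with mean $0$ and covariance matrix $S$. Let $R\in\mathbb{C}^{M\times M}$ be Hermitian positive semidefinite, $U\in\mathbb{C}^{M\times N}$, $\alpha_2,\dots,\alpha_\tau\in\mathbb{C}$ (deterministic), and let $\tilde R=U^{\rm H}R^{*}U$, where $R^*$ is the entrywise complex conjugate; assume $\tilde R\ne 0$. Let $n_2,\dots,n_\tau\sim\mathcal{CN}(0,\sigma^2 I_N)$ and $h\sim\mathcal{CN}(0,R)$ be independent random vectors. The observations are $$\mathcal{H}_0:\ \bar y_i=n_i,\qquad \mathcal{H}_1:\ \bar y_i=\sqrt{\tau q}\,\alpha_i\,U^{\rm H}h^{*}+n_i,\qquad i=2,\dots,\tau .$$ Let $\tilde R=V\,\mathrm{diag}(\lambda_1,\dots,\lambda_N)V^{\rm H}$ be an eigenvalue decomposition with $V=[v_1,\dots,v_N]$ unitary and $\lambda_1\ge\dots\ge\lambda_\rho>0=\lambda_{\rho+1}=\dots=\lambda_N$, where $\rho=\operatorname{rank}\tilde R$, and let $$T_{\rm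 LMPT}=\sum_{i=2}^{\tau}\sum_{n=1}^{N}\lambda_n\,|\bar y_i^{\rm H}v_n|^2 .$$ (i) Under $\mathcal{H}_0$, $T_{\rm LMPT}$ has a probability density function, which vanishes for $x\le 0$ and for $x>0$ equals the convergent series $$f_T(x;\mathcal{H}_0)=\sum_{m=0}^\infty\frac{a_m}{\Gamma((\tau-1)\rho+m)\,(2\beta)^{(\tau-1)\rho+m}}\,x^{(\tau-1)\rho+m-1}e^{-x/(2\beta)},$$ where $\beta=\dfrac{\rho}{2\sum_{j=1}^{\rho}(\lambda_j\sigma^2)^{-1}}$, $a_0=\prod_{j=1}^{\rho}\Big(\dfrac{2\beta}{\lambda_j\sigma^2}\Big)^{\tau-1}$, $b_m=2(\tau-1)\sum_{j=1}^{\rho}\Big(1-\dfrac{2\beta}{\lambda_j\sigma^2}\Big)^m$ and $a_m=\dfrac{1}{2m}\sum_{r=0}^{m-1}b_{m-r}a_r$ for all $m\ge 1$. (ii) Under $\mathcal{H}_1$, let $R_{\bar y}=\mathbb{E}[\bar y\bar y^{\rm H}]$ be the covariance matrix of the stacked vector $\bar y=[\bar y_2^{\rm T},\dots,\bar y_\tau^{\rm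 T}]^{\rm T}$, let $B=R_{\bar y}^{1/2}(I_{\tau-1}\otimes\tilde R)R_{\bar y}^{1/2}$, $\varphi=\operatorname{rank}B$, and let $\epsilon_1,\dots,\epsilon_\varphi$ be the positive eigenvalues of $B$, counted with multiplicity (there are exactly $\varphi$ of them). Then $T_{\rm LMPT}$ has a probability density function, which vanishes for $x\le 0$ and for $x>0$ equals the convergent series $$f_T(x;\mathcal{H}_1)=\sum_{m=0}^\infty\frac{\bar a_m}{\Gamma(\varphi+m)\,(2\bar\beta)^{\varphi+m}}\,x^{\varphi+m-1}e^{-x/(2\bar\beta)},$$ where $\bar\beta=\dfrac{\varphi}{2\sum_{j=1}^{\varphi}\epsilon_j^{-1}}$, $\bar a_0=\prod_{j=1}^{\varphi}\dfrac{2\bar\beta}{\epsilon_j}$, $\bar b_m=2\sum_{j=1}^{\varphi}\Big(1-\dfrac{2\bar\beta}{\epsilon_j}\Big)^m$ and $\bar a_m=\dfrac{1}{2m}\sum_{r=0}^{m-1}\bar b_{m-r}\bar a_r$ for all $m\ge 1$. -/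

import Mathlib

open MeasureTheory ProbabilityTheory Matrix
open scoped ComplexOrder MatrixOrder Kronecker

noncomputable section

namespace LMPT

/-- The circularly symmetric complex Gaussian law `CN(μ, S)` on `ℂ^ι`, for `S` positive
semidefinite: the law of `μ + S^{1/2} z`, where the real and imaginary parts of the entries of `z`
are independent real Gaussians with mean `0` and variance `1 / 2`.  (`stdGaussian` gives variance
`1` to each real coordinate of `ℂ^ι`, whence the factor `1 / √2`.) -/
def complexGaussian {ι : Type*} [Fintype ι] [DecidableEq ι] (μ : ι → ℂ) (S : Matrix ι ι ℂ) :
    Measure (ι → ℂ) :=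
  (stdGaussian (EuclideanSpace ℂ ι)).map
    (fun z => μ + CFC.sqrt S *ᵥ ((√2)⁻¹ • z.ofLp))

/-- `f` is a probability density function, with respect to Lebesgue measure, of the real random
variable `X` on the probability space `(Ω, P)`. -/
structure IsPDF {Ω : Type*} [MeasurableSpace Ω] (P : Measure Ω) (X : Ω → ℝ) (f : ℝ → ℝ) :
    Prop where
  measurable : Measurable f
  nonneg : ∀ x, 0 ≤ f x
  hasLaw : HasLaw X (volume.withDensity (fun x => ENNReal.ofReal (f x))) P

/-! ### The observations, the statistic and the matrices attached to them

The unused pilots, with numbers `2, …, τ`, are indexed by `Fin (τ - 1)`. -/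

/-- The beam-domain covariance matrix `R̃ = Uᴴ R* U` of the jamming channel, where `R*` is the
entrywise complex conjugate of the channel covariance matrix `R`. -/
def beamCov {M N : ℕ} (U : Matrix (Fin M) (Fin N) ℂ) (R : Matrix (Fin M) (Fin M) ℂ) :
    Matrix (Fin N) (Fin N) ℂ :=
  Uᴴ * R.map star * U

/-- The projected observation vectors when the jammer is present,
`y_i = √(τ q) α_i Uᴴ h* + n_i`. (When it is absent, `y_i = n_i`.) -/
def obsH1 {Ω : Type*} {τ M N : ℕ} (q : ℝ) (α : Fin (τ - 1) → ℂ) (U : Matrix (Fin M) (Fin N) ℂ)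
    (h : Ω → Fin M → ℂ) (n : Fin (τ - 1) → Ω → Fin N → ℂ) :
    Fin (τ - 1) → Ω → Fin N → ℂ :=
  fun i ω => ((√(τ * q) : ℝ) * α i : ℂ) • (Uᴴ *ᵥ star (h ω)) + n i ω

/-- The statistic `T = ∑ i, ∑ n, lam n * |y_iᴴ v_n|²`, where `v_n` is the `n`-th column of `V`. -/
def statistic {Ω : Type*} {τ N : ℕ} (lam : Fin N → ℝ) (V : Matrix (Fin N) (Fin N) ℂ)
    (y : Fin (τ - 1) → Ω → Fin N → ℂ) : Ω → ℝ :=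
  fun ω => ∑ i, ∑ n, lam n * ‖star (y i ω) ⬝ᵥ V.col n‖ ^ 2

/-- The covariance matrix `E[y yᴴ]` of the stacked (zero-mean) observation vector
`y = (y_i)_i`. -/
def stackedCov {Ω : Type*} [MeasurableSpace Ω] (P : Measure Ω) {τ N : ℕ}
    (y : Fin (τ - 1) → Ω → Fin N → ℂ) :
    Matrix (Fin (τ - 1) × Fin N) (Fin (τ - 1) × Fin N) ℂ :=
  Matrix.of fun s t => ∫ ω, y s.1 ω s.2 * star (y t.1 ω t.2) ∂P

/-- The matrix `B = R_y^{1/2} (I ⊗ R̃) R_y^{1/2}`. -/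
def matB {τ N : ℕ} (Ry : Matrix (Fin (τ - 1) × Fin N) (Fin (τ - 1) × Fin N) ℂ)
    (Rt : Matrix (Fin N) (Fin N) ℂ) :
    Matrix (Fin (τ - 1) × Fin N) (Fin (τ - 1) × Fin N) ℂ :=
  CFC.sqrt Ry * ((1 : Matrix (Fin (τ - 1)) (Fin (τ - 1)) ℂ) ⊗ₖ Rt) * CFC.sqrt Ry

/-- `ε` lists the positive eigenvalues of `A`, each as often as its algebraic multiplicity. -/
def IsPosEigenvalues {ι : Type*} [Fintype ι] [DecidableEq ι] (A : Matrix ι ι ℂ) {r : ℕ}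
    (ε : Fin r → ℝ) : Prop :=
  (∀ j, 0 < ε j) ∧ ∀ x : ℝ, 0 < x →
    A.charpoly.rootMultiplicity (x : ℂ) = (Finset.univ.filter fun j => ε j = x).card

/-! ### The gamma series

`θ_1, …, θ_r` are positive weights and `d` is their common multiplicity. -/

/-- `β = r / (2 ∑ j, 1 / θ_j)`. -/
def beta {r : ℕ} (θ : Fin r → ℝ) : ℝ :=
  r / (2 * ∑ j, (θ j)⁻¹)

/-- `b_m = 2 d ∑ j, (1 - 2 β / θ_j) ^ m`. -/
def coeffB (d : ℕ) {r : ℕ} (θ : Fin r → ℝ) (m : ℕ) : ℝ :=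
  2 * d * ∑ j, (1 - 2 * beta θ / θ j) ^ m

/-- `a_0 = ∏ j, (2 β / θ_j) ^ d` and `a_m = 1 / (2 m) ∑_{r < m} b_{m - r} a_r` for `m ≥ 1`. -/
def coeffA (d : ℕ) {r : ℕ} (θ : Fin r → ℝ) : ℕ → ℝ
  | 0 => ∏ j, (2 * beta θ / θ j) ^ d
  | m + 1 => 1 / (2 * ((m + 1 : ℕ) : ℝ)) *
      ∑ s : Fin (m + 1), coeffB d θ (m + 1 - s) * coeffA d θ s
decreasing_by exact s.isLt

/-- The `m`-th term
`a_m / (Γ(d r + m) (2 β)^(d r + m)) * x^(d r + m - 1) * exp (- x / (2 β))`. -/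
def term (d : ℕ) {r : ℕ} (θ : Fin r → ℝ) (x : ℝ) (m : ℕ) : ℝ :=
  coeffA d θ m / (Real.Gamma ((d * r + m : ℕ) : ℝ) * (2 * beta θ) ^ (d * r + m)) *
    x ^ (((d * r + m : ℕ) : ℝ) - 1) * Real.exp (-x / (2 * beta θ))

/-- The sum of the series on the positive half-line, and `0` elsewhere. -/
def seriesPDF (d : ℕ) {r : ℕ} (θ : Fin r → ℝ) (x : ℝ) : ℝ :=
  if 0 < x then ∑' m, term d θ x m else 0

end LMPT

end

/-!
In both situations the stacked observation vector `y` is `CN(0, S)` with an explicit `S`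
(`hasLaw_stacked_obsH1`, by characteristic functions; the absence of the jammer is the case
`q = 0`, where `S = σ² I`), and the statistic is the Hermitian form `yᴴ (I ⊗ R̃) y`. Writing
`y = S^{1/2} z / √2` with a standard Gaussian vector `z` and rotating `z` into an eigenbasis of
`B = S^{1/2} (I ⊗ R̃) S^{1/2}` turns it into `∑ k, μ_k |z_k|² / 2`, with `μ_k` the eigenvalues of
`B` and `|z_k|² / 2` independent standard exponential variables. So its Laplace transform is
`∏ k, 1 / (1 + s μ_k) = 1 / det (1 + s B)` (`laplace_statistic`), in which only the positive
eigenvalues matter. When `S = σ² I`, the determinant is that of `1 + s σ² R̃` to the power `τ - 1`.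

It remains to see that a random variable with Laplace transform `∏ j, (1 + s θ_j) ^ (-d)` has the
gamma series as density (`isPDF_seriesPDF_of_laplace`). The recursion for the coefficients `a_m` is
the differential equation of the generating function
`∑ a_m w ^ m = ∏ j, ((2 β / θ_j) / (1 - (1 - 2 β / θ_j) w)) ^ d` (`mk_coeffA`), and at
`w = 1 / (1 + 2 β s)` this generating function is, up to the factor `w ^ (d r)`, the Laplace
transform of the series, integrated term by term (`laplace_seriesPDF`). As `|1 - 2 β / θ_j|` may
exceed `1`, the generating function converges for small `w` only, that is for large `s`, where the
two Laplace transforms therefore agree. This is enough: after multiplication by `exp (-s x)` with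
`s` large, the moment generating functions of finite measures agree near `0`, and these determine
the measures (`ext_of_mgf_eq_of_abs_lt`). The sign of the terms being unknown, the series is split
into its positive and negative parts, and its nonnegativity is a consequence
(`eq_withDensity_of_laplace_eq`).
-/

namespace LMPT

/-! ### The generating function of the coefficients -/

/-- The geometric power series `∑ γ ^ m X ^ m = (1 - γ X)⁻¹`. -/
noncomputable def geomSeries (γ : ℝ) : PowerSeries ℝ := PowerSeries.mk fun m => γ ^ m

lemma geomSeries_mul (γ : ℝ) :
    geomSeries γ * (1 - PowerSeries.C γ * PowerSeries.X) = 1 := by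
  ext (_ | m)
  · simp [geomSeries]
  · rw [mul_sub, mul_one, mul_comm (PowerSeries.C γ), ← mul_assoc, map_sub,
      PowerSeries.coeff_mul_C, PowerSeries.coeff_succ_mul_X]
    simp [geomSeries, PowerSeries.coeff_one, pow_succ]

lemma derivative_geomSeries (γ : ℝ) :
    PowerSeries.derivative ℝ (geomSeries γ) =
      geomSeries γ * (PowerSeries.C γ * geomSeries γ) := by
  rw [Derivation.leibniz_of_mul_eq_one _ (geomSeries_mul γ)]
  have : PowerSeries.derivative ℝ (PowerSeries.C γ) = 0 := by
    ext m; simp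
  simp [Derivation.leibniz, this]
  ring

/-- `H` plays the role of the logarithmic derivative of `F`, without division. -/
lemma derivative_pow_of_logDeriv {F H : PowerSeries ℝ}
    (h : PowerSeries.derivative ℝ F = F * H) (d : ℕ) :
    PowerSeries.derivative ℝ (F ^ d) = F ^ d * ((d : PowerSeries ℝ) * H) := by
  induction d with
  | zero => simp
  | succ d ih =>
    rw [pow_succ, Derivation.leibniz, ih, h]
    simp only [smul_eq_mul]; push_cast; ring

lemma derivative_prod_of_logDeriv {ι : Type*} (s : Finset ι) {F H : ι → PowerSeries ℝ}
    (h : ∀ j, PowerSeries.derivative ℝ (F j) = F j * H j) :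
    PowerSeries.derivative ℝ (∏ j ∈ s, F j) = (∏ j ∈ s, F j) * ∑ j ∈ s, H j := by
  classical
  induction s using Finset.induction_on with
  | empty => simp
  | insert a s ha ih =>
    rw [Finset.prod_insert ha, Finset.sum_insert ha, Derivation.leibniz, ih, h]
    simp only [smul_eq_mul]; ring

/-- The power series `F` converges absolutely at `w`, with sum `v`. -/
def AbsSumAt (w : ℝ) (F : PowerSeries ℝ) (v : ℝ) : Prop :=
  Summable (fun m => ‖PowerSeries.coeff m F * w ^ m‖) ∧
    ∑' m, PowerSeries.coeff m F * w ^ m = v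

lemma absSumAt_C (w c : ℝ) : AbsSumAt w (PowerSeries.C c) c := by
  have h : ∀ m, m ≠ 0 → PowerSeries.coeff m (PowerSeries.C c) * w ^ m = 0 := fun m hm => by
    simp [PowerSeries.coeff_C, hm]
  refine ⟨summable_of_ne_finset_zero (s := {0}) fun m hm => ?_, ?_⟩
  · rw [h m (by simpa using hm), norm_zero]
  · rw [tsum_eq_single 0 h]; simp

lemma AbsSumAt.mul {w u v : ℝ} {F G : PowerSeries ℝ} (hF : AbsSumAt w F u)
    (hG : AbsSumAt w G v) : AbsSumAt w (F * G) (u * v) := by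
  have h : ∀ m, PowerSeries.coeff m (F * G) * w ^ m =
      ∑ kl ∈ Finset.HasAntidiagonal.antidiagonal m, (PowerSeries.coeff kl.1 F * w ^ kl.1) *
        (PowerSeries.coeff kl.2 G * w ^ kl.2) := by
    intro m
    rw [PowerSeries.coeff_mul, Finset.sum_mul]
    refine Finset.sum_congr rfl fun kl hkl => ?_
    rw [← Finset.HasAntidiagonal.mem_antidiagonal.1 hkl, pow_add]; ring
  refine ⟨?_, ?_⟩
  · exact (summable_norm_sum_mul_antidiagonal_of_summable_norm hF.1 hG.1).congr
      fun m => by rw [h]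
  · rw [tsum_congr h, ← tsum_mul_tsum_eq_tsum_sum_antidiagonal_of_summable_norm hF.1 hG.1,
      hF.2, hG.2]

lemma AbsSumAt.pow {w u : ℝ} {F : PowerSeries ℝ} (hF : AbsSumAt w F u) (d : ℕ) :
    AbsSumAt w (F ^ d) (u ^ d) := by
  induction d with
  | zero => simpa using absSumAt_C w 1
  | succ d ih => rw [pow_succ, pow_succ]; exact ih.mul hF

lemma AbsSumAt.prod {ι : Type*} (s : Finset ι) {w : ℝ} {u : ι → ℝ} {F : ι → PowerSeries ℝ}
    (hF : ∀ j, AbsSumAt w (F j) (u j)) : AbsSumAt w (∏ j ∈ s, F j) (∏ j ∈ s, u j) := by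
  classical
  induction s using Finset.induction_on with
  | empty => simpa using absSumAt_C w 1
  | insert a s ha ih => rw [Finset.prod_insert ha, Finset.prod_insert ha]; exact (hF a).mul ih

lemma absSumAt_geomSeries {w γ : ℝ} (h : |γ * w| < 1) :
    AbsSumAt w (geomSeries γ) (1 - γ * w)⁻¹ := by
  have e : (fun m => PowerSeries.coeff m (geomSeries γ) * w ^ m) = fun m => (γ * w) ^ m := by
    ext m; simp [geomSeries, mul_pow]
  refine ⟨?_, ?_⟩
  · rw [funext_iff] at e
    simp_rw [e]
    exact summable_norm_geometric_of_norm_lt_one h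
  · rw [e, tsum_geometric_of_norm_lt_one h]

section

variable {r : ℕ}

lemma coeffA_zero (d : ℕ) (θ : Fin r → ℝ) : coeffA d θ 0 = ∏ j, (2 * beta θ / θ j) ^ d := by
  rw [coeffA]

lemma coeffA_succ (d : ℕ) (θ : Fin r → ℝ) (m : ℕ) :
    coeffA d θ (m + 1) = 1 / (2 * ((m + 1 : ℕ) : ℝ)) *
      ∑ s : Fin (m + 1), coeffB d θ (m + 1 - s) * coeffA d θ s := by
  rw [coeffA]

/-- The recursion for `coeffA` says that its generating function `A` satisfies
`A' = A ∑ j, d γ_j / (1 - γ_j X)`, where `γ_j = 1 - 2 β / θ_j`; hence `A` is the product of powers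
of geometric series with the same constant coefficient. -/
lemma mk_coeffA (d : ℕ) (θ : Fin r → ℝ) :
    PowerSeries.mk (coeffA d θ) =
      PowerSeries.C (coeffA d θ 0) * ∏ j, geomSeries (1 - 2 * beta θ / θ j) ^ d := by
  set F := ∏ j, geomSeries (1 - 2 * beta θ / θ j) ^ d with hF
  have hF0 : PowerSeries.coeff 0 F = 1 := by
    simp [hF, geomSeries, map_prod]
  have hD := derivative_prod_of_logDeriv Finset.univ fun j : Fin r =>
    derivative_pow_of_logDeriv (derivative_geomSeries (1 - 2 * beta θ / θ j)) d
  rw [← hF] at hD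
  have hcoef : ∀ k, PowerSeries.coeff k (∑ j : Fin r, (d : PowerSeries ℝ) *
      (PowerSeries.C (1 - 2 * beta θ / θ j) * geomSeries (1 - 2 * beta θ / θ j))) =
        coeffB d θ (k + 1) / 2 := by
    intro k
    have : (d : PowerSeries ℝ) = PowerSeries.C (d : ℝ) := by simp
    simp only [this, map_sum, PowerSeries.coeff_C_mul, coeffB, geomSeries, PowerSeries.coeff_mk,
      Finset.mul_sum, Finset.sum_div]
    refine Finset.sum_congr rfl fun j _ => ?_
    ring
  ext m
  rw [PowerSeries.coeff_mk, PowerSeries.coeff_C_mul]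
  induction m using Nat.strong_induction_on with
  | _ m ih =>
    rcases m with _ | m
    · rw [hF0, mul_one]
    · have h := congrArg (PowerSeries.coeff m) hD
      rw [PowerSeries.coeff_derivative, PowerSeries.coeff_mul,
        Finset.Nat.sum_antidiagonal_eq_sum_range_succ_mk, Finset.sum_range] at h
      simp only [hcoef] at h
      have hm : ((m : ℝ) + 1) ≠ 0 := by positivity
      rw [coeffA_succ, eq_div_of_mul_eq hm h]
      push_cast
      rw [one_div, mul_inv, div_eq_mul_inv, Finset.mul_sum, Finset.sum_mul,
        Finset.mul_sum]
      refine Finset.sum_congr rfl fun s _ => ?_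
      rw [ih s s.isLt, Nat.succ_sub (Nat.lt_succ_iff.1 s.isLt)]
      ring

lemma absSumAt_coeffA (d : ℕ) (θ : Fin r → ℝ) {w : ℝ}
    (hw : ∀ j, |(1 - 2 * beta θ / θ j) * w| < 1) :
    AbsSumAt w (PowerSeries.mk (coeffA d θ))
      (∏ j, (2 * beta θ / θ j * (1 - (1 - 2 * beta θ / θ j) * w)⁻¹) ^ d) := by
  simp_rw [mul_pow]
  rw [mk_coeffA, coeffA_zero, Finset.prod_mul_distrib]
  exact (absSumAt_C _ _).mul (AbsSumAt.prod _ fun j => (absSumAt_geomSeries (hw j)).pow d)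

/-- A radius below which the generating function of `coeffA` converges. -/
noncomputable def radius (θ : Fin r → ℝ) : ℝ := (1 + ∑ j, |1 - 2 * beta θ / θ j|)⁻¹

lemma radius_pos (θ : Fin r → ℝ) : 0 < radius θ := by
  unfold radius; positivity

lemma abs_mul_lt_one_of_le_radius (θ : Fin r → ℝ) {w : ℝ} (hw0 : 0 ≤ w) (hw : w ≤ radius θ)
    (j : Fin r) : |(1 - 2 * beta θ / θ j) * w| < 1 := by
  have h1 : |1 - 2 * beta θ / θ j| ≤ ∑ j, |1 - 2 * beta θ / θ j| :=
    Finset.single_le_sum (f := fun j => |1 - 2 * beta θ / θ j|) (fun _ _ => abs_nonneg _)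
      (Finset.mem_univ j)
  have h2 : 0 < 1 + ∑ j, |1 - 2 * beta θ / θ j| := by positivity
  rw [abs_mul, abs_of_nonneg hw0]
  calc _ ≤ |1 - 2 * beta θ / θ j| * radius θ := by gcongr
    _ < 1 := by
      rw [radius, ← div_eq_mul_inv, div_lt_one h2]; linarith

lemma exists_abs_coeffA_le (d : ℕ) (θ : Fin r → ℝ) :
    ∃ C, 0 ≤ C ∧ ∀ m, |coeffA d θ m| ≤ C * (radius θ)⁻¹ ^ m := by
  have h := absSumAt_coeffA d θ (abs_mul_lt_one_of_le_radius θ (radius_pos θ).le le_rfl)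
  refine ⟨∑' m, ‖PowerSeries.coeff m (PowerSeries.mk (coeffA d θ)) * radius θ ^ m‖,
    tsum_nonneg fun _ => norm_nonneg _, fun m => ?_⟩
  have := h.1.le_tsum m fun _ _ => norm_nonneg _
  rw [inv_pow, ← div_eq_mul_inv, le_div_iff₀ (pow_pos (radius_pos θ) m)]
  simpa [abs_mul, abs_of_pos (radius_pos θ)] using this

/-! ### The gamma series -/

lemma beta_pos (hr : 0 < r) {θ : Fin r → ℝ} (hθ : ∀ j, 0 < θ j) : 0 < beta θ := by
  have : 0 < ∑ j, (θ j)⁻¹ :=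
    Finset.sum_pos (fun j _ => inv_pos.2 (hθ j)) ⟨⟨0, hr⟩, Finset.mem_univ _⟩
  have : (0 : ℝ) < r := by exact_mod_cast hr
  unfold beta; positivity

/-- For `d r > 0` the term has a factorial and a natural exponent in place of `Γ` and a real
power. -/
lemma term_eq {d : ℕ} (hn : 0 < d * r) (θ : Fin r → ℝ) (x : ℝ) (m : ℕ) :
    term d θ x m = coeffA d θ m / ((d * r + m - 1).factorial * (2 * beta θ) ^ (d * r + m)) *
      x ^ (d * r + m - 1) * Real.exp (-x / (2 * beta θ)) := by
  obtain ⟨k, hk⟩ : ∃ k, d * r + m = k + 1 := ⟨d * r + m - 1, by omega⟩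
  rw [term, hk]
  push_cast
  rw [Real.Gamma_nat_eq_factorial, add_sub_cancel_right, Real.rpow_natCast]

lemma continuous_term {d : ℕ} (hn : 0 < d * r) (θ : Fin r → ℝ) (m : ℕ) :
    Continuous fun x => term d θ x m := by
  simp_rw [term_eq hn]
  fun_prop

/-- The factorials beat the geometric growth of `coeffA`, so that the gamma series converges
uniformly on bounded intervals, although `|1 - 2 β / θ_j|` may exceed `1`. -/
lemma exists_norm_term_le {d : ℕ} (hn : 0 < d * r) {θ : Fin r → ℝ} (hθ : ∀ j, 0 < θ j) (b : ℝ) :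
    ∃ u : ℕ → ℝ, Summable u ∧ ∀ m x, 0 ≤ x → x ≤ b → ‖term d θ x m‖ ≤ u m := by
  have hr : 0 < r := Nat.pos_of_mul_pos_left hn
  have hβ := beta_pos hr hθ
  obtain ⟨C, hC, hA⟩ := exists_abs_coeffA_le d θ
  have hρ := radius_pos θ
  refine ⟨fun m => C * b ^ (d * r - 1) / (2 * beta θ) ^ (d * r) *
    (((radius θ)⁻¹ * b / (2 * beta θ)) ^ m / m.factorial),
    (Real.summable_pow_div_factorial _).mul_left _, fun m x hx hxb => ?_⟩
  rw [term_eq hn, norm_mul, norm_mul, norm_div, norm_mul, norm_pow, norm_pow, Real.norm_natCast,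
    Real.norm_eq_abs, Real.norm_of_nonneg hx, Real.norm_of_nonneg (Real.exp_pos _).le,
    Real.norm_of_nonneg (by positivity : 0 ≤ 2 * beta θ)]
  have h1 : Real.exp (-x / (2 * beta θ)) ≤ 1 := by
    rw [Real.exp_le_one_iff, neg_div, Left.neg_nonpos_iff]; positivity
  have h2 : (m.factorial : ℝ) ≤ ((d * r + m - 1).factorial : ℕ) := by
    exact_mod_cast Nat.factorial_le (by omega)
  have hb : 0 ≤ b := hx.trans hxb
  have h3 : d * r + m - 1 = (d * r - 1) + m := by omega
  calc _ ≤ (C * (radius θ)⁻¹ ^ m) / (m.factorial * (2 * beta θ) ^ (d * r + m)) *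
        b ^ (d * r + m - 1) * 1 := by
        have := hA m
        gcongr
    _ = _ := by
        rw [h3, pow_add, pow_add]
        simp only [div_pow, mul_pow]
        field_simp

lemma summable_term {d : ℕ} (hn : 0 < d * r) {θ : Fin r → ℝ} (hθ : ∀ j, 0 < θ j) {x : ℝ}
    (hx : 0 ≤ x) : Summable (term d θ x) := by
  obtain ⟨u, hu, h⟩ := exists_norm_term_le hn hθ x
  exact Summable.of_norm_bounded hu fun m => h m x hx le_rfl

lemma continuousOn_seriesPDF {d : ℕ} (hn : 0 < d * r) {θ : Fin r → ℝ} (hθ : ∀ j, 0 < θ j) :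
    ContinuousOn (seriesPDF d θ) (Set.Ioi 0) := by
  have h : ContinuousOn (fun x => ∑' m, term d θ x m) (Set.Ioi 0) := by
    intro x hx
    obtain ⟨u, hu, h⟩ := exists_norm_term_le hn hθ (x + 1)
    have := continuousOn_tsum (s := Set.Icc 0 (x + 1))
      (fun m => (continuous_term hn θ m).continuousOn) hu (fun m y hy => h m y hy.1 hy.2)
    exact (this.continuousAt (Icc_mem_nhds hx (by linarith))).continuousWithinAt
  exact h.congr fun x hx => if_pos hx

lemma measurable_seriesPDF {d : ℕ} (hn : 0 < d * r) {θ : Fin r → ℝ} (hθ : ∀ j, 0 < θ j) :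
    Measurable (seriesPDF d θ) := by
  have : seriesPDF d θ = (Set.Ioi 0).piecewise (seriesPDF d θ) 0 := by
    ext x
    by_cases hx : 0 < x <;> simp [Set.piecewise, seriesPDF, hx]
  rw [this]
  exact (continuousOn_seriesPDF hn hθ).measurable_piecewise continuousOn_const measurableSet_Ioi

lemma integral_exp_mul_pow {s b : ℝ} (hs : 0 ≤ s) (hb : 0 < b) (k : ℕ) :
    ∫ x in Set.Ioi (0 : ℝ), Real.exp (-(s * x)) * (x ^ k * Real.exp (-x / b)) =
      (b * (1 + b * s)⁻¹) ^ (k + 1) * k.factorial := by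
  have h := Real.integral_rpow_mul_exp_neg_mul_Ioi (a := k + 1) (r := s + 1 / b)
    (by positivity) (by positivity)
  rw [Real.Gamma_nat_eq_factorial] at h
  have e : 1 / (s + 1 / b) = b * (1 + b * s)⁻¹ := by
    have : 0 < 1 + b * s := by positivity
    field_simp; ring
  rw [e, ← Nat.cast_succ, Real.rpow_natCast] at h
  rw [← h]
  refine setIntegral_congr_fun measurableSet_Ioi fun x _ => ?_
  simp only [Nat.cast_succ, add_sub_cancel_right, Real.rpow_natCast]
  rw [mul_left_comm, ← Real.exp_add]
  congr 2
  field_simp; ring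

lemma integrableOn_exp_mul_pow {s b : ℝ} (hs : 0 ≤ s) (hb : 0 < b) (k : ℕ) :
    IntegrableOn (fun x => Real.exp (-(s * x)) * (x ^ k * Real.exp (-x / b))) (Set.Ioi 0) := by
  -- a nonintegrable function has integral `0`
  refine Integrable.of_integral_ne_zero ?_
  rw [integral_exp_mul_pow hs hb]
  positivity

/-- The Laplace transform of the gamma series, integrated term by term, is the generating function
of its coefficients at `w = 1 / (1 + 2 β s)`, up to the factor `w ^ (d r)`. -/
lemma laplace_seriesPDF {d : ℕ} (hn : 0 < d * r) {θ : Fin r → ℝ} (hθ : ∀ j, 0 < θ j) {s : ℝ}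
    (hs : 0 ≤ s) (hw : (1 + 2 * beta θ * s)⁻¹ ≤ radius θ) :
    Integrable (fun x => Real.exp (-(s * x)) * seriesPDF d θ x) ∧
      ∫ x, Real.exp (-(s * x)) * seriesPDF d θ x = ∏ j, (1 + s * θ j)⁻¹ ^ d := by
  have hr : 0 < r := Nat.pos_of_mul_pos_left hn
  have hβ := beta_pos hr hθ
  set w := (1 + 2 * beta θ * s)⁻¹ with hwdef
  have hw1 : 0 < 1 + 2 * beta θ * s := by positivity
  have hw0 : 0 < w := inv_pos.2 hw1
  have hsum := absSumAt_coeffA d θ (abs_mul_lt_one_of_le_radius θ hw0.le hw)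
  set c : ℕ → ℝ := fun m =>
    coeffA d θ m / ((d * r + m - 1).factorial * (2 * beta θ) ^ (d * r + m)) with hc
  have hterm : ∀ m x, Real.exp (-(s * x)) * term d θ x m =
      c m * (Real.exp (-(s * x)) * (x ^ (d * r + m - 1) * Real.exp (-x / (2 * beta θ)))) := by
    intro m x; rw [term_eq hn]; ring
  have hcm : ∀ m, c m * ((2 * beta θ * w) ^ (d * r + m) * (d * r + m - 1).factorial) =
      w ^ (d * r) * (coeffA d θ m * w ^ m) := by
    intro m
    have : ((d * r + m - 1).factorial : ℝ) ≠ 0 := by positivity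
    simp only [hc]
    rw [mul_pow _ w, pow_add w]
    field_simp
  have hint : ∀ m, IntegrableOn (fun x => Real.exp (-(s * x)) * term d θ x m) (Set.Ioi 0) := by
    intro m
    simp_rw [hterm]
    exact (integrableOn_exp_mul_pow hs (by positivity) _).const_mul _
  have hval : ∀ m, ∫ x in Set.Ioi (0 : ℝ), Real.exp (-(s * x)) * term d θ x m =
      w ^ (d * r) * (coeffA d θ m * w ^ m) := by
    intro m
    simp_rw [hterm]
    rw [integral_const_mul, integral_exp_mul_pow hs (by positivity),
      Nat.sub_add_cancel (by omega), hcm]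
  have hnorm : ∀ m, ∫ x in Set.Ioi (0 : ℝ), ‖Real.exp (-(s * x)) * term d θ x m‖ =
      w ^ (d * r) * ‖coeffA d θ m * w ^ m‖ := by
    intro m
    have e : ∀ x ∈ Set.Ioi (0 : ℝ), ‖Real.exp (-(s * x)) * term d θ x m‖ = |c m| *
        (Real.exp (-(s * x)) * (x ^ (d * r + m - 1) * Real.exp (-x / (2 * beta θ)))) := by
      intro x hx
      have hx : 0 < x := hx
      rw [hterm, norm_mul, Real.norm_eq_abs, Real.norm_of_nonneg (by positivity)]
    rw [setIntegral_congr_fun measurableSet_Ioi e, integral_const_mul,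
      integral_exp_mul_pow hs (by positivity), Nat.sub_add_cancel (by omega)]
    have h := congrArg abs (hcm m)
    rw [abs_mul, abs_of_nonneg (a := _ * (((_ : ℕ) : ℝ))) (by positivity), abs_mul,
      abs_of_nonneg (a := w ^ (d * r)) (by positivity)] at h
    exact h
  have hsn : Summable fun m => ∫ x in Set.Ioi (0 : ℝ), ‖Real.exp (-(s * x)) * term d θ x m‖ := by
    simp_rw [hnorm]
    simpa using hsum.1.mul_left (w ^ (d * r))
  have hf : ∀ x ∈ Set.Ioi (0 : ℝ), Real.exp (-(s * x)) * seriesPDF d θ x =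
      ∑' m, Real.exp (-(s * x)) * term d θ x m := fun x hx => by
    rw [seriesPDF, if_pos (by exact hx), tsum_mul_left]
  have hzero : ∀ x, x ∉ Set.Ioi (0 : ℝ) → Real.exp (-(s * x)) * seriesPDF d θ x = 0 :=
    fun x hx => by rw [seriesPDF, if_neg (by exact hx), mul_zero]
  have key : ∫ x, Real.exp (-(s * x)) * seriesPDF d θ x = ∏ j, (1 + s * θ j)⁻¹ ^ d := by
    rw [← setIntegral_eq_integral_of_forall_compl_eq_zero (s := Set.Ioi 0) hzero,
      setIntegral_congr_fun measurableSet_Ioi hf,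
      ← integral_tsum_of_summable_integral_norm hint hsn]
    simp_rw [hval]
    rw [tsum_mul_left]
    have h2 := hsum.2
    simp only [PowerSeries.coeff_mk] at h2
    rw [h2, mul_comm d r, pow_mul', ← Fin.prod_const r (w ^ d), ← Finset.prod_mul_distrib]
    refine Finset.prod_congr rfl fun j _ => ?_
    rw [← mul_pow]
    congr 1
    have := hθ j
    have h3 : 1 - (1 - 2 * beta θ / θ j) * w = 2 * beta θ / θ j * w * (1 + s * θ j) := by
      rw [hwdef]; field_simp; ring
    rw [h3]
    field_simp
  -- a nonintegrable function has integral `0`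
  refine ⟨Integrable.of_integral_ne_zero ?_, key⟩
  rw [key]
  refine (Finset.prod_pos fun j _ => ?_).ne'
  have := hθ j
  positivity

/-! ### A law with given Laplace transform for large arguments -/

open Filter Topology in
/-- Finite measures on `ℝ` whose moment generating functions agree near `0` are equal: both extend
analytically to a vertical strip containing the imaginary axis. -/
lemma ext_of_mgf_eq_of_abs_lt {μ ν : Measure ℝ} [IsFiniteMeasure μ] [IsFiniteMeasure ν] {a : ℝ}
    (ha : 0 < a) (hμ : ∀ t, |t| < a → Integrable (fun x => Real.exp (t * x)) μ)
    (hν : ∀ t, |t| < a → Integrable (fun x => Real.exp (t * x)) ν)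
    (h : ∀ t, |t| < a → ∫ x, Real.exp (t * x) ∂μ = ∫ x, Real.exp (t * x) ∂ν) : μ = ν := by
  set S : Set ℂ := Complex.reLm ⁻¹' Set.Ioo (-a) a with hS
  have hint : ∀ κ : Measure ℝ, (∀ t, |t| < a → Integrable (fun x => Real.exp (t * x)) κ) →
      AnalyticOnNhd ℂ (complexMGF id κ) S := by
    intro κ hκ z hz
    refine analyticOnNhd_complexMGF z ?_
    exact interior_maximal (fun t ht => hκ t (abs_lt.2 ht)) isOpen_Ioo hz
  have hpre : IsPreconnected S := ((convex_Ioo (-a) a).linear_preimage Complex.reLm).isPreconnected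
  have hfreq : ∃ᶠ z in 𝓝[≠] ((0 : ℝ) : ℂ), complexMGF id μ z = complexMGF id ν z := by
    have hev : ∀ᶠ t : ℝ in 𝓝[≠] 0, complexMGF id μ t = complexMGF id ν t := by
      filter_upwards [nhdsWithin_le_nhds (Ioo_mem_nhds (neg_lt_zero.2 ha) ha)] with t ht
      rw [complexMGF_ofReal, complexMGF_ofReal]
      exact congrArg _ (h t (abs_lt.2 ht))
    have hmap : Tendsto (fun t : ℝ => (t : ℂ)) (𝓝[≠] 0) (𝓝[≠] ((0 : ℝ) : ℂ)) :=
      Complex.continuous_ofReal.continuousAt.continuousWithinAt.tendsto_nhdsWithin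
        fun t ht => by simpa using ht
    exact hmap.frequently hev.frequently
  have heq := AnalyticOnNhd.eqOn_of_preconnected_of_frequently_eq (hint μ hμ) (hint ν hν) hpre
    (z₀ := ((0 : ℝ) : ℂ)) (by simp [hS, ha]) hfreq
  refine Measure.ext_of_charFun (funext fun t => ?_)
  rw [← complexMGF_id_mul_I, ← complexMGF_id_mul_I]
  exact heq (by simp [hS, ha])

lemma integrable_withDensity_ofReal_iff {m : Measure ℝ} {k g : ℝ → ℝ} (hk : Measurable k) :
    Integrable g (m.withDensity fun x => ENNReal.ofReal (k x)) ↔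
      Integrable (fun x => max (k x) 0 * g x) m := by
  rw [integrable_withDensity_iff_integrable_smul' hk.ennreal_ofReal (by simp)]
  simp [ENNReal.toReal_ofReal']

lemma integral_withDensity_ofReal {m : Measure ℝ} {k : ℝ → ℝ} (g : ℝ → ℝ) (hk : Measurable k) :
    ∫ x, g x ∂(m.withDensity fun x => ENNReal.ofReal (k x)) = ∫ x, max (k x) 0 * g x ∂m := by
  rw [integral_withDensity_eq_integral_toReal_smul hk.ennreal_ofReal (by simp)]
  simp [ENNReal.toReal_ofReal']

/-- A function `f`, not assumed nonnegative, with the same Laplace transform as a probability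
measure `ν` for all large arguments is its density. -/
lemma eq_withDensity_of_laplace_eq {ν : Measure ℝ} [IsProbabilityMeasure ν] {f : ℝ → ℝ}
    (hf : Measurable f) {s₀ : ℝ}
    (hν : ∀ s, s₀ ≤ s → Integrable (fun x => Real.exp (-(s * x))) ν)
    (hint : ∀ s, s₀ ≤ s → Integrable fun x => Real.exp (-(s * x)) * f x)
    (h : ∀ s, s₀ ≤ s → ∫ x, Real.exp (-(s * x)) ∂ν = ∫ x, Real.exp (-(s * x)) * f x) :
    (∀ᵐ x, 0 ≤ f x) ∧ ν = volume.withDensity fun x => ENNReal.ofReal (f x) := by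
  -- multiplying by `exp (-s x)`, for some `s > s₀`, yields finite measures with finite moments
  set s := s₀ + 1 with hs
  set E : ℝ → ℝ := fun x => Real.exp (-(s * x)) with hE
  have hEm : Measurable E := by fun_prop
  have hEmax : ∀ x, max (E x) 0 = E x := fun x => max_eq_left (Real.exp_pos _).le
  have hFm : Measurable fun x => E x * f x := hEm.mul hf
  have hGm : Measurable fun x => -(E x * f x) := hFm.neg
  have hmul : ∀ t x, E x * Real.exp (t * x) = Real.exp (-((s - t) * x)) := fun t x => by
    rw [hE, ← Real.exp_add]; ring_nf
  have hle : ∀ t, |t| < 1 → s₀ ≤ s - t := fun t ht => by have := (abs_lt.1 ht).2; linarith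
  have hmaxp : ∀ t x, max (E x * f x) 0 * Real.exp (t * x) =
      max (Real.exp (-((s - t) * x)) * f x) 0 := fun t x => by
    rw [max_mul_of_nonneg _ _ (Real.exp_pos _).le, zero_mul, ← hmul, mul_right_comm]
  have hmaxn : ∀ t x, max (-(E x * f x)) 0 * Real.exp (t * x) =
      max (-(Real.exp (-((s - t) * x)) * f x)) 0 := fun t x => by
    rw [max_mul_of_nonneg _ _ (Real.exp_pos _).le, zero_mul, ← hmul, neg_mul, mul_right_comm]
  have hs₀ : s₀ ≤ s := by linarith
  set ν' := ν.withDensity fun x => ENNReal.ofReal (E x)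
  set μn : Measure ℝ := volume.withDensity fun x => ENNReal.ofReal (-(E x * f x))
  set μp : Measure ℝ := volume.withDensity fun x => ENNReal.ofReal (E x * f x)
  have : IsFiniteMeasure ν' := isFiniteMeasure_withDensity_ofReal (hν s hs₀).2
  have : IsFiniteMeasure μn := isFiniteMeasure_withDensity_ofReal (hint s hs₀).neg.2
  have : IsFiniteMeasure μp := isFiniteMeasure_withDensity_ofReal (hint s hs₀).2
  have hiν : ∀ t, |t| < 1 → Integrable (fun x => Real.exp (t * x)) ν' := fun t ht => by
    rw [integrable_withDensity_ofReal_iff hEm]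
    simp_rw [hEmax, hmul]
    exact hν _ (hle t ht)
  have hin : ∀ t, |t| < 1 → Integrable (fun x => Real.exp (t * x)) μn := fun t ht => by
    rw [integrable_withDensity_ofReal_iff hGm]
    simp_rw [hmaxn]
    exact (hint _ (hle t ht)).neg_part
  have hip : ∀ t, |t| < 1 → Integrable (fun x => Real.exp (t * x)) μp := fun t ht => by
    rw [integrable_withDensity_ofReal_iff hFm]
    simp_rw [hmaxp]
    exact (hint _ (hle t ht)).pos_part
  -- `f` is split into its positive and negative parts, to compare two (nonnegative) measures
  have hmain : ν' + μn = μp := by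
    refine ext_of_mgf_eq_of_abs_lt one_pos (fun t ht => (hiν t ht).add_measure (hin t ht)) hip
      fun t ht => ?_
    rw [integral_add_measure (hiν t ht) (hin t ht), integral_withDensity_ofReal _ hEm,
      integral_withDensity_ofReal _ hGm, integral_withDensity_ofReal _ hFm]
    simp_rw [hEmax, hmul, hmaxn, hmaxp]
    rw [h _ (hle t ht), ← integral_add (hint _ (hle t ht)) (hint _ (hle t ht)).neg_part]
    refine integral_congr_ae (.of_forall fun x => ?_)
    rcases le_total 0 (Real.exp (-((s - t) * x)) * f x) with h0 | h0
    · simp [h0]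
    · simp [h0]
  -- division by `exp (-s x)` recovers the original measures
  have hback : ∀ (m : Measure ℝ) (k : ℝ → ℝ), Measurable k →
      (m.withDensity fun x => ENNReal.ofReal (E x * k x)).withDensity
        (fun x => ENNReal.ofReal (E x)⁻¹) = m.withDensity fun x => ENNReal.ofReal (k x) := by
    intro m k hk
    have hEk : Measurable fun x => ENNReal.ofReal (E x * k x) := (hEm.mul hk).ennreal_ofReal
    have hEi : Measurable fun x => ENNReal.ofReal (E x)⁻¹ := hEm.inv.ennreal_ofReal
    rw [← withDensity_mul _ hEk hEi]
    congr 1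
    ext x
    have : 0 < E x := Real.exp_pos _
    rw [Pi.mul_apply, ← ENNReal.ofReal_mul' (by positivity)]
    congr 1
    field_simp
  have hmain' : ν + (volume.withDensity fun x => ENNReal.ofReal (-f x)) =
      volume.withDensity fun x => ENNReal.ofReal (f x) := by
    have h1 := hback ν 1 measurable_const
    have h2 := hback volume (fun x => -f x) hf.neg
    simp only [Pi.one_apply, mul_one, ENNReal.ofReal_one, mul_neg] at h1 h2
    have h3 : ν.withDensity (fun _ => 1) = ν := withDensity_one
    rw [h3] at h1
    rw [← hback volume f hf, ← h1, ← h2]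
    have := congrArg (fun m : Measure ℝ => m.withDensity fun x => ENNReal.ofReal (E x)⁻¹) hmain
    simpa only [withDensity_add_measure] using this
  have hA : MeasurableSet {x | f x < 0} := measurableSet_lt hf measurable_const
  have hfn : Measurable fun x => ENNReal.ofReal (-f x) := hf.neg.ennreal_ofReal
  have hnn : ∀ᵐ x, ENNReal.ofReal (-f x) = 0 := by
    have h0 : (volume.withDensity fun x => ENNReal.ofReal (f x)) {x | f x < 0} = 0 := by
      rw [withDensity_apply _ hA]
      refine setLIntegral_eq_zero hA fun x hx => ENNReal.ofReal_of_nonpos (le_of_lt hx)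
    rw [← hmain', Measure.add_apply, add_eq_zero, withDensity_apply _ hA,
      setLIntegral_eq_zero_iff hA hfn] at h0
    filter_upwards [h0.2] with x hx
    by_cases hx0 : f x < 0
    · exact hx hx0
    · exact ENNReal.ofReal_of_nonpos (by linarith)
  refine ⟨hnn.mono fun x hx => by simpa using hx, ?_⟩
  rw [← hmain', withDensity_congr_ae (g := fun _ => 0) hnn]
  simp

/-- A random variable with Laplace transform `∏ j, (1 + s θ_j) ^ (-d)`, i.e. with the law of a sum
of independent gamma variables of shape `d` and scales `θ_j`, has the gamma series as density. -/
theorem isPDF_seriesPDF_of_laplace {Ω : Type*} [MeasurableSpace Ω] {P : Measure Ω}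
    [IsProbabilityMeasure P] {X : Ω → ℝ} (hX : AEMeasurable X P) {d : ℕ} (hn : 0 < d * r)
    {θ : Fin r → ℝ} (hθ : ∀ j, 0 < θ j)
    (hL : ∀ s, 0 ≤ s → ∫ ω, Real.exp (-(s * X ω)) ∂P = ∏ j, (1 + s * θ j)⁻¹ ^ d) :
    IsPDF P X (seriesPDF d θ) := by
  have hβ := beta_pos (Nat.pos_of_mul_pos_left hn) hθ
  have hρ := radius_pos θ
  have hf := measurable_seriesPDF hn hθ
  have : IsProbabilityMeasure (P.map X) := Measure.isProbabilityMeasure_map hX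
  set s₀ := (radius θ)⁻¹ / (2 * beta θ) with hs₀
  have hs₀0 : 0 ≤ s₀ := by positivity
  have hw : ∀ s, s₀ ≤ s → (1 + 2 * beta θ * s)⁻¹ ≤ radius θ := fun s hs => by
    rw [inv_le_comm₀ (by have := hs₀0.trans hs; positivity) hρ]
    rw [hs₀, div_le_iff₀ (by positivity)] at hs
    linarith
  have hmap : ∀ s, s₀ ≤ s →
      ∫ x, Real.exp (-(s * x)) ∂(P.map X) = ∏ j, (1 + s * θ j)⁻¹ ^ d := fun s hs => by
    rw [integral_map hX (by fun_prop), hL s (hs₀0.trans hs)]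
  obtain ⟨hnn, hlaw⟩ := eq_withDensity_of_laplace_eq (ν := P.map X) hf (s₀ := s₀)
    (fun s hs => by
      -- a nonintegrable function has integral `0`
      refine Integrable.of_integral_ne_zero ?_
      rw [hmap s hs]
      refine (Finset.prod_pos fun j _ => ?_).ne'
      have := hθ j
      have := hs₀0.trans hs
      positivity)
    (fun s hs => (laplace_seriesPDF hn hθ (hs₀0.trans hs) (hw s hs)).1)
    (fun s hs => by rw [hmap s hs, (laplace_seriesPDF hn hθ (hs₀0.trans hs) (hw s hs)).2])
  refine ⟨hf, fun x => ?_, hX, hlaw⟩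
  -- `0 ≤ f` holds almost everywhere, hence everywhere by continuity on the positive half-line
  by_cases hx : 0 < x
  · have hc := continuousOn_seriesPDF hn hθ
    have heq := Measure.eqOn_open_of_ae_eq (μ := volume)
      (ae_restrict_of_ae (hnn.mono fun x hx => (abs_of_nonneg hx).symm)) isOpen_Ioi hc hc.abs
    rw [heq hx]
    exact abs_nonneg _
  · rw [seriesPDF, if_neg hx]

end

/-! ### The complex Gaussian law -/

section

variable {ι : Type*} [Fintype ι]

lemma real_inner_eq_re_inner_euclideanSpace (a b : EuclideanSpace ℂ ι) :
    inner ℝ a b = (inner ℂ a b).re := by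
  rw [PiLp.inner_apply, PiLp.inner_apply, Complex.re_sum]
  rfl

lemma integrable_inner_mul_inner_stdGaussian (u v : EuclideanSpace ℂ ι) :
    Integrable (fun z => inner ℝ u z * inner ℝ v z) (stdGaussian (EuclideanSpace ℂ ι)) := by
  have h : MemLp (id : EuclideanSpace ℂ ι → _) 2 (stdGaussian (EuclideanSpace ℂ ι)) :=
    IsGaussian.memLp_two_id
  exact (h.const_inner u).integrable_mul (h.const_inner v)

lemma integral_inner_mul_inner_stdGaussian (u v : EuclideanSpace ℂ ι) :
    ∫ z, inner ℝ u z * inner ℝ v z ∂(stdGaussian (EuclideanSpace ℂ ι)) = inner ℝ u v := by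
  have h := covarianceBilin_apply (μ := stdGaussian (EuclideanSpace ℂ ι))
    IsGaussian.memLp_two_id u v
  rw [covarianceBilin_stdGaussian] at h
  simp only [id_eq, integral_id_stdGaussian, sub_zero] at h
  exact h.symm

/-- `E[⟨u, z⟩ ⟨z, v⟩] = 2 ⟨u, v⟩`: each complex coordinate of `z` has variance `2`. -/
lemma integral_inner_mul_inner_complex_stdGaussian (u v : EuclideanSpace ℂ ι) :
    ∫ z, inner ℂ u z * inner ℂ z v ∂(stdGaussian (EuclideanSpace ℂ ι)) = 2 * inner ℂ u v := by
  have him : ∀ a b : EuclideanSpace ℂ ι, (inner ℂ a b).im = inner ℝ (Complex.I • a) b := by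
    intro a b
    rw [real_inner_eq_re_inner_euclideanSpace, inner_smul_left]; simp
  have hre : ∀ a b : EuclideanSpace ℂ ι, (inner ℂ a b).re = inner ℝ a b :=
    fun a b => (real_inner_eq_re_inner_euclideanSpace a b).symm
  have hdec : ∀ z : EuclideanSpace ℂ ι, inner ℂ u z * inner ℂ z v =
      ((inner ℝ u z * inner ℝ v z + inner ℝ (Complex.I • u) z * inner ℝ (Complex.I • v) z : ℝ) : ℂ)
      + ((inner ℝ (Complex.I • u) z * inner ℝ v z -
        inner ℝ u z * inner ℝ (Complex.I • v) z : ℝ) : ℂ) * Complex.I := by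
    intro z
    rw [← inner_conj_symm z v, ← him, ← him, ← hre, ← hre]
    generalize inner ℂ u z = p
    generalize inner ℂ v z = w
    apply Complex.ext
    · simp
    · simp; ring
  simp_rw [hdec]
  have hi := integrable_inner_mul_inner_stdGaussian (ι := ι)
  rw [integral_add ((hi _ _).add (hi _ _)).ofReal (((hi _ _).sub (hi _ _)).ofReal.mul_const _),
    integral_mul_const, integral_complex_ofReal, integral_complex_ofReal,
    integral_add (hi _ _) (hi _ _), integral_sub (hi _ _) (hi _ _)]
  simp_rw [integral_inner_mul_inner_stdGaussian]
  have h1 : inner ℝ (Complex.I • u) (Complex.I • v) = inner ℝ u v := by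
    rw [← hre, ← hre, inner_smul_left, inner_smul_right]
    simp [← mul_assoc]
  have h2 : inner ℝ u (Complex.I • v) = - inner ℝ (Complex.I • u) v := by
    rw [← hre, ← hre, inner_smul_left, inner_smul_right]
    simp
  rw [h1, h2]
  apply Complex.ext
  · simp [hre]; ring
  · simp [him]; ring

/-- The standard Gaussian law on `ℂ^ι` has independent standard Gaussian complex coordinates. -/
lemma stdGaussian_eq_map_pi :
    stdGaussian (EuclideanSpace ℂ ι) =
      (Measure.pi fun _ : ι => stdGaussian ℂ).map (WithLp.toLp 2) := by
  have : IsProbabilityMeasure ((Measure.pi fun _ : ι => stdGaussian ℂ).map (WithLp.toLp 2)) :=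
    Measure.isProbabilityMeasure_map (by fun_prop)
  apply Measure.ext_of_charFun
  ext t
  rw [charFun_pi, charFun_stdGaussian]
  simp_rw [charFun_stdGaussian, ← Complex.exp_sum, ← Complex.ofReal_pow,
    EuclideanSpace.norm_sq_eq]
  simp [Finset.sum_div, neg_div]

lemma integral_exp_neg_sq_gaussianReal {a : ℝ} (ha : 0 ≤ a) :
    ∫ x, Real.exp (-(a / 2 * x ^ 2)) ∂(gaussianReal 0 1) = (√(1 + a))⁻¹ := by
  rw [integral_gaussianReal_eq_integral_smul one_ne_zero]
  have h : ∀ x : ℝ, gaussianPDFReal 0 1 x • Real.exp (-(a / 2 * x ^ 2)) =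
      (√(2 * Real.pi))⁻¹ * Real.exp (-((1 + a) / 2) * x ^ 2) := by
    intro x
    rw [gaussianPDFReal, smul_eq_mul, mul_assoc, ← Real.exp_add]
    simp only [NNReal.coe_one, mul_one, sub_zero]
    congr 2
    ring
  simp_rw [h]
  rw [integral_const_mul, integral_gaussian, ← Real.sqrt_inv, ← Real.sqrt_inv, ← Real.sqrt_mul
    (by positivity)]
  congr 1
  have := Real.pi_pos
  field_simp

lemma integral_exp_neg_norm_sq_stdGaussian_complex {a : ℝ} (ha : 0 ≤ a) :
    ∫ z, Real.exp (-(a / 2 * ‖z‖ ^ 2)) ∂(stdGaussian ℂ) = (1 + a)⁻¹ := by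
  rw [stdGaussian_eq_map_pi_orthonormalBasis Complex.orthonormalBasisOneI,
    integral_map (Measurable.aemeasurable (by fun_prop)) (by fun_prop)]
  have h : ∀ x : Fin 2 → ℝ,
      Real.exp (-(a / 2 * ‖∑ i, x i • Complex.orthonormalBasisOneI i‖ ^ 2)) =
        ∏ i, Real.exp (-(a / 2 * x i ^ 2)) := by
    intro x
    rw [← Real.exp_sum, ← Complex.normSq_eq_norm_sq]
    simp [Complex.normSq_apply]
    ring
  simp_rw [h]
  rw [integral_fintype_prod_eq_prod (fun (_ : Fin 2) (x : ℝ) => Real.exp (-(a / 2 * x ^ 2)))]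
  simp_rw [integral_exp_neg_sq_gaussianReal ha]
  rw [Fin.prod_const, inv_pow, Real.sq_sqrt (by positivity)]

lemma integral_exp_neg_sum_norm_sq_stdGaussian {a : ι → ℝ} (ha : ∀ k, 0 ≤ a k) :
    ∫ z, Real.exp (-(∑ k, a k / 2 * ‖z k‖ ^ 2)) ∂(stdGaussian (EuclideanSpace ℂ ι)) =
      ∏ k, (1 + a k)⁻¹ := by
  rw [stdGaussian_eq_map_pi, integral_map (by fun_prop) (by fun_prop)]
  simp_rw [← Finset.sum_neg_distrib, Real.exp_sum]
  rw [integral_fintype_prod_eq_prod (fun k (z : ℂ) => Real.exp (-(a k / 2 * ‖z‖ ^ 2)))]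
  simp_rw [integral_exp_neg_norm_sq_stdGaussian_complex (ha _)]

lemma real_inner_toLp (z : EuclideanSpace ℂ ι) (t : ι → ℂ) :
    inner ℝ z (WithLp.toLp 2 t) = (star t ⬝ᵥ z.ofLp).re := by
  rw [real_inner_comm, real_inner_eq_re_inner_euclideanSpace, EuclideanSpace.inner_eq_star_dotProduct, dotProduct_comm]

lemma norm_sq_toLp (t : ι → ℂ) : ‖WithLp.toLp 2 t‖ ^ 2 = (star t ⬝ᵥ t).re := by
  rw [← real_inner_self_eq_norm_sq, real_inner_toLp]

lemma star_mulVec_dotProduct {m : Type*} [Fintype m] (A : Matrix m ι ℂ) (v : ι → ℂ) (w : m → ℂ) :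
    star (A *ᵥ v) ⬝ᵥ w = star v ⬝ᵥ (Aᴴ *ᵥ w) := by
  rw [star_mulVec, ← dotProduct_mulVec]

/-- Finite measures on `ℂ^ι` are determined by their characteristic functions. -/
lemma ext_of_integral_exp_dotProduct {μ ν : Measure (ι → ℂ)} [IsFiniteMeasure μ]
    [IsFiniteMeasure ν]
    (h : ∀ t : ι → ℂ, ∫ y, Complex.exp ((star t ⬝ᵥ y).re * Complex.I) ∂μ =
      ∫ y, Complex.exp ((star t ⬝ᵥ y).re * Complex.I) ∂ν) : μ = ν := by
  have hm : Measurable (WithLp.toLp 2 : (ι → ℂ) → EuclideanSpace ℂ ι) := by fun_prop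
  have hm' : Measurable (WithLp.ofLp : EuclideanSpace ℂ ι → ι → ℂ) := by fun_prop
  have key : μ.map (WithLp.toLp 2 : (ι → ℂ) → EuclideanSpace ℂ ι) = ν.map (WithLp.toLp 2) := by
    apply Measure.ext_of_charFun
    ext t
    rw [charFun_apply, charFun_apply, integral_map hm.aemeasurable (by fun_prop),
      integral_map hm.aemeasurable (by fun_prop)]
    have e : ∀ y : ι → ℂ, inner ℝ (WithLp.toLp 2 y) t = (star t.ofLp ⬝ᵥ y).re :=
      fun y => real_inner_toLp (WithLp.toLp 2 y) t.ofLp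
    simp_rw [e]
    exact h t.ofLp
  have := congrArg (fun κ => κ.map WithLp.ofLp) key
  simp only [Measure.map_map hm' hm] at this
  simpa [Function.comp_def] using this

variable [DecidableEq ι]

/-- The standard Gaussian law is invariant under unitary matrices. -/
lemma stdGaussian_map_mulVec {W : Matrix ι ι ℂ} (hW : W * Wᴴ = 1) :
    (stdGaussian (EuclideanSpace ℂ ι)).map (fun z => WithLp.toLp 2 (W *ᵥ z.ofLp)) =
      stdGaussian (EuclideanSpace ℂ ι) := by
  have hm : Measurable fun z : EuclideanSpace ℂ ι => WithLp.toLp 2 (W *ᵥ z.ofLp) := by fun_prop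
  have : IsProbabilityMeasure ((stdGaussian (EuclideanSpace ℂ ι)).map
      (fun z => WithLp.toLp 2 (W *ᵥ z.ofLp))) := Measure.isProbabilityMeasure_map hm.aemeasurable
  apply Measure.ext_of_charFun
  ext t
  have h : ∀ z : EuclideanSpace ℂ ι, inner ℝ (WithLp.toLp 2 (W *ᵥ z.ofLp)) t =
      inner ℝ z (WithLp.toLp 2 (Wᴴ *ᵥ t.ofLp)) := by
    intro z
    rw [real_inner_toLp z, star_mulVec_dotProduct, conjTranspose_conjTranspose]
    exact real_inner_toLp (WithLp.toLp 2 (W *ᵥ z.ofLp)) t.ofLp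
  rw [charFun_apply, integral_map hm.aemeasurable (by fun_prop)]
  simp_rw [h]
  rw [← charFun_apply, charFun_stdGaussian, charFun_stdGaussian]
  have : ‖WithLp.toLp 2 (Wᴴ *ᵥ t.ofLp)‖ = ‖t‖ := by
    rw [← sq_eq_sq₀ (norm_nonneg _) (norm_nonneg _), norm_sq_toLp, star_mulVec_dotProduct,
      conjTranspose_conjTranspose, mulVec_mulVec, hW, one_mulVec]
    exact (norm_sq_toLp t.ofLp).symm
  rw [this]

lemma sqrt_mul_sqrt_of_posSemidef {S : Matrix ι ι ℂ} (hS : S.PosSemidef) :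
    CFC.sqrt S * CFC.sqrt S = S :=
  CFC.sqrt_mul_sqrt_self S (nonneg_iff_posSemidef.2 hS)

lemma conjTranspose_sqrt (S : Matrix ι ι ℂ) : (CFC.sqrt S)ᴴ = CFC.sqrt S :=
  (nonneg_iff_posSemidef.1 (CFC.sqrt_nonneg S)).isHermitian

lemma measurable_sqrt_mulVec_smul (S : Matrix ι ι ℂ) :
    Measurable fun z : EuclideanSpace ℂ ι => 0 + CFC.sqrt S *ᵥ ((√2)⁻¹ • z.ofLp) := by
  fun_prop

instance (S : Matrix ι ι ℂ) : IsProbabilityMeasure (complexGaussian 0 S) :=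
  Measure.isProbabilityMeasure_map (measurable_sqrt_mulVec_smul S).aemeasurable

/-- Integration against `CN(0, S)` in terms of the standard Gaussian vector. -/
lemma integral_complexGaussian {E : Type*} [NormedAddCommGroup E] [NormedSpace ℝ E]
    (S : Matrix ι ι ℂ) {g : (ι → ℂ) → E} (hg : Continuous g) :
    ∫ y, g y ∂(complexGaussian 0 S) =
      ∫ z : EuclideanSpace ℂ ι, g ((√2)⁻¹ • CFC.sqrt S *ᵥ z.ofLp) ∂(stdGaussian _) := by
  rw [complexGaussian, integral_map (measurable_sqrt_mulVec_smul S).aemeasurable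
    hg.aestronglyMeasurable]
  simp only [zero_add, mulVec_smul]

/-- The characteristic function of `CN(0, S)` is `t ↦ exp (-tᴴ S t / 4)`. -/
lemma charFun_complexGaussian {S : Matrix ι ι ℂ} (hS : S.PosSemidef) (t : ι → ℂ) :
    ∫ y, Complex.exp ((star t ⬝ᵥ y).re * Complex.I) ∂(complexGaussian 0 S) =
      Complex.exp (-((star t ⬝ᵥ S *ᵥ t).re / 4 : ℝ)) := by
  rw [integral_complexGaussian S (by unfold dotProduct; fun_prop)]
  have h : ∀ z : EuclideanSpace ℂ ι, (star t ⬝ᵥ ((√2)⁻¹ • CFC.sqrt S *ᵥ z.ofLp)).re =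
      inner ℝ z (WithLp.toLp 2 ((√2)⁻¹ • CFC.sqrt S *ᵥ t)) := by
    intro z
    rw [real_inner_toLp, star_smul, smul_dotProduct, star_mulVec_dotProduct, conjTranspose_sqrt,
      dotProduct_smul]
    simp
  simp_rw [h]
  rw [← charFun_apply, charFun_stdGaussian]
  congr 1
  rw [← Complex.ofReal_pow, norm_sq_toLp, star_smul, smul_dotProduct, dotProduct_smul,
    star_mulVec_dotProduct, conjTranspose_sqrt, mulVec_mulVec, sqrt_mul_sqrt_of_posSemidef hS,
    smul_smul]
  have h2 : star (√2)⁻¹ * (√2)⁻¹ = 1 / 2 := by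
    rw [star_trivial, ← mul_inv, Real.mul_self_sqrt zero_le_two, one_div]
  rw [h2, Complex.smul_re, smul_eq_mul]
  push_cast
  ring

/-- `S` is the covariance matrix of `CN(0, S)`: an entry of `S^{1/2} z` is an inner product of `z`
with a row of `S^{1/2}`. -/
lemma integral_mul_star_complexGaussian {S : Matrix ι ι ℂ} (hS : S.PosSemidef) (a b : ι) :
    ∫ y, y a * star (y b) ∂(complexGaussian 0 S) = S a b := by
  rw [integral_complexGaussian S (g := fun y => y a * star (y b)) (by fun_prop)]
  set u : ι → EuclideanSpace ℂ ι := fun a => WithLp.toLp 2 (star (CFC.sqrt S a)) with hu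
  have h : ∀ (a : ι) (z : EuclideanSpace ℂ ι), (CFC.sqrt S *ᵥ z.ofLp) a = inner ℂ (u a) z := by
    intro a z
    rw [hu, EuclideanSpace.inner_eq_star_dotProduct, star_star, dotProduct_comm]
    rfl
  have h' : ∀ z : EuclideanSpace ℂ ι, ((√2)⁻¹ • CFC.sqrt S *ᵥ z.ofLp) a *
      star (((√2)⁻¹ • CFC.sqrt S *ᵥ z.ofLp) b) = 1 / 2 * (inner ℂ (u a) z * inner ℂ z (u b)) := by
    intro z
    rw [Pi.smul_apply, Pi.smul_apply, h, h, star_smul, smul_mul_smul_comm, star_trivial, ← mul_inv,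
      Real.mul_self_sqrt zero_le_two, ← inner_conj_symm z (u b)]
    simp
  simp_rw [h']
  rw [integral_const_mul, integral_inner_mul_inner_complex_stdGaussian, ← mul_assoc]
  rw [hu, EuclideanSpace.inner_eq_star_dotProduct, star_star, dotProduct_comm]
  conv_rhs => rw [← sqrt_mul_sqrt_of_posSemidef hS, mul_apply']
  norm_num
  congr 1
  ext k
  conv_rhs => rw [← conjTranspose_sqrt]
  rfl

/-! ### Quadratic forms in a complex Gaussian vector -/

/-- A Hermitian form in diagonalized shape is a weighted sum of squared moduli. -/
lemma re_quadForm_diagonalization {m : Type*} [Fintype m] (W : Matrix m ι ℂ) (lam : ι → ℝ)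
    (y : m → ℂ) :
    (star y ⬝ᵥ (W * diagonal (fun k => (lam k : ℂ)) * Wᴴ) *ᵥ y).re =
      ∑ k, lam k * ‖(Wᴴ *ᵥ y) k‖ ^ 2 := by
  classical
  have h : star y ⬝ᵥ (W * diagonal (fun k => (lam k : ℂ)) * Wᴴ) *ᵥ y =
      star (Wᴴ *ᵥ y) ⬝ᵥ diagonal (fun k => (lam k : ℂ)) *ᵥ (Wᴴ *ᵥ y) := by
    rw [star_mulVec_dotProduct, conjTranspose_conjTranspose, mulVec_mulVec, mulVec_mulVec,
      Matrix.mul_assoc]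
  rw [h, dotProduct, Complex.re_sum]
  refine Finset.sum_congr rfl fun k _ => ?_
  rw [mulVec_diagonal, Pi.star_apply, mul_left_comm, ← Complex.normSq_eq_norm_sq,
    Complex.star_def, Complex.normSq_eq_conj_mul_self.symm, ← Complex.ofReal_mul,
    Complex.ofReal_re]

lemma posSemidef_sqrt_mul_mul_sqrt (S : Matrix ι ι ℂ) {K : Matrix ι ι ℂ} (hK : K.PosSemidef) :
    (CFC.sqrt S * K * CFC.sqrt S).PosSemidef := by
  have := hK.mul_mul_conjTranspose_same (CFC.sqrt S)
  rwa [conjTranspose_sqrt] at this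

/-- The Laplace transform of the quadratic form `yᴴ K y` for `y ∼ CN(0, S)`: the vector `y` is
`S^{1/2} z / √2`, and `z` may be replaced by its coordinates in an eigenbasis of
`S^{1/2} K S^{1/2}`. -/
lemma laplace_quadForm_complexGaussian {S K : Matrix ι ι ℂ}
    (hB : (CFC.sqrt S * K * CFC.sqrt S).PosSemidef) {s : ℝ} (hs : 0 ≤ s) :
    ∫ y, Real.exp (-(s * (star y ⬝ᵥ K *ᵥ y).re)) ∂(complexGaussian 0 S) =
      ∏ k, (1 + s * hB.isHermitian.eigenvalues k)⁻¹ := by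
  set μ := hB.isHermitian.eigenvalues with hμ
  set W : Matrix ι ι ℂ := (hB.isHermitian.eigenvectorUnitary : Matrix ι ι ℂ) with hW
  have hWW : Wᴴ * Wᴴᴴ = 1 := by
    rw [conjTranspose_conjTranspose]
    exact Unitary.coe_star_mul_self hB.isHermitian.eigenvectorUnitary
  have hspec : CFC.sqrt S * K * CFC.sqrt S = W * diagonal (fun k => (μ k : ℂ)) * Wᴴ :=
    hB.isHermitian.spectral_theorem
  rw [integral_complexGaussian S
    (g := fun y => Real.exp (-(s * (star y ⬝ᵥ K *ᵥ y).re)))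
    (by unfold dotProduct mulVec dotProduct; fun_prop)]
  set F : EuclideanSpace ℂ ι → ℝ := fun z => Real.exp (-(∑ k, s * μ k / 2 * ‖z k‖ ^ 2)) with hF
  have h : ∀ z : EuclideanSpace ℂ ι,
      Real.exp (-(s * (star ((√2)⁻¹ • CFC.sqrt S *ᵥ z.ofLp) ⬝ᵥ
        K *ᵥ ((√2)⁻¹ • CFC.sqrt S *ᵥ z.ofLp)).re)) =
      F (WithLp.toLp 2 (Wᴴ *ᵥ z.ofLp)) := by
    intro z
    have h2 : star (√2)⁻¹ * (√2)⁻¹ = 1 / 2 := by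
      rw [star_trivial, ← mul_inv, Real.mul_self_sqrt zero_le_two, one_div]
    rw [star_smul, smul_dotProduct, mulVec_smul, dotProduct_smul, star_mulVec_dotProduct,
      conjTranspose_sqrt, smul_smul, h2, mulVec_mulVec, mulVec_mulVec, hspec,
      Complex.smul_re, re_quadForm_diagonalization, smul_eq_mul, ← mul_assoc, Finset.mul_sum]
    refine congrArg (fun x => Real.exp (-x)) ?_
    refine Finset.sum_congr rfl fun k _ => ?_
    ring
  rw [integral_congr_ae (.of_forall h),
    ← integral_map (φ := fun z : EuclideanSpace ℂ ι => WithLp.toLp 2 (Wᴴ *ᵥ z.ofLp))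
    (by fun_prop) (by fun_prop), stdGaussian_map_mulVec hWW]
  exact integral_exp_neg_sum_norm_sq_stdGaussian
    fun k => mul_nonneg hs (hB.eigenvalues_nonneg k)

end

/-! ### The law of the stacked observation -/

section

variable {τ M N : ℕ}

/-- The matrix `C` for which `Cᴴ h*` is the jamming part of the stacked observation vector. -/
noncomputable def jammingMatrix (q : ℝ) (α : Fin (τ - 1) → ℂ) (U : Matrix (Fin M) (Fin N) ℂ) :
    Matrix (Fin M) (Fin (τ - 1) × Fin N) ℂ :=
  Matrix.of fun m s => star ((√(τ * q) : ℝ) * α s.1 : ℂ) * U m s.2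

/-- The covariance matrix `Cᴴ R* C + σ² I` of the stacked observation vector. -/
noncomputable def obsCov (σ q : ℝ) (α : Fin (τ - 1) → ℂ) (U : Matrix (Fin M) (Fin N) ℂ)
    (R : Matrix (Fin M) (Fin M) ℂ) :
    Matrix (Fin (τ - 1) × Fin N) (Fin (τ - 1) × Fin N) ℂ :=
  (jammingMatrix q α U)ᴴ * R.map star * jammingMatrix q α U +
    ((σ ^ 2 : ℝ) : ℂ) • (1 : Matrix (Fin (τ - 1) × Fin N) (Fin (τ - 1) × Fin N) ℂ)

lemma posSemidef_map_star {R : Matrix (Fin M) (Fin M) ℂ} (hR : R.PosSemidef) :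
    (R.map star).PosSemidef := by
  have : R.map star = Rᵀ := by
    rw [← congrArg transpose hR.isHermitian.eq, conjTranspose, transpose_map, transpose_transpose]
  rw [this]
  exact hR.transpose

lemma posSemidef_sq_smul_one {ι : Type*} [Fintype ι] [DecidableEq ι] (σ : ℝ) :
    (((σ ^ 2 : ℝ) : ℂ) • (1 : Matrix ι ι ℂ)).PosSemidef :=
  PosSemidef.one.smul (by exact_mod_cast sq_nonneg σ)

lemma posSemidef_obsCov (σ q : ℝ) (α : Fin (τ - 1) → ℂ) (U : Matrix (Fin M) (Fin N) ℂ)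
    {R : Matrix (Fin M) (Fin M) ℂ} (hR : R.PosSemidef) : (obsCov σ q α U R).PosSemidef :=
  ((posSemidef_map_star hR).conjTranspose_mul_mul_same _).add (posSemidef_sq_smul_one σ)

lemma posSemidef_beamCov (U : Matrix (Fin M) (Fin N) ℂ) {R : Matrix (Fin M) (Fin M) ℂ}
    (hR : R.PosSemidef) : (beamCov U R).PosSemidef :=
  (posSemidef_map_star hR).conjTranspose_mul_mul_same _

lemma continuous_exp_re_dotProduct {ι : Type*} [Fintype ι] (t : ι → ℂ) :
    Continuous fun y : ι → ℂ => Complex.exp ((t ⬝ᵥ y).re * Complex.I) := by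
  unfold dotProduct
  fun_prop

lemma re_dotProduct_obsH1 {Ω : Type*} (q : ℝ) (α : Fin (τ - 1) → ℂ)
    (U : Matrix (Fin M) (Fin N) ℂ) (h : Ω → Fin M → ℂ) (n : Fin (τ - 1) → Ω → Fin N → ℂ)
    (t : Fin (τ - 1) × Fin N → ℂ) (ω : Ω) :
    (star t ⬝ᵥ fun s => obsH1 q α U h n s.1 ω s.2).re =
      (star (star (jammingMatrix q α U *ᵥ t)) ⬝ᵥ h ω).re +
        ∑ i, (star (fun k => t (i, k)) ⬝ᵥ n i ω).re := by
  have e : (fun s : Fin (τ - 1) × Fin N => obsH1 q α U h n s.1 ω s.2) =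
      (jammingMatrix q α U)ᴴ *ᵥ star (h ω) + fun s => n s.1 ω s.2 := by
    ext s
    simp [obsH1, jammingMatrix, mulVec, dotProduct, Finset.mul_sum, mul_assoc]
  rw [e, dotProduct_add, Complex.add_re, ← star_mulVec_dotProduct, ← Complex.re_sum]
  congr 1
  · rw [star_dotProduct_star, star_star, dotProduct_comm, Complex.star_def, Complex.conj_re]
  · congr 1
    simp only [dotProduct, Fintype.sum_prod_type]
    rfl

lemma aemeasurable_stacked_obsH1 {Ω : Type*} [MeasurableSpace Ω] {P : Measure Ω}
    (q : ℝ) (α : Fin (τ - 1) → ℂ) (U : Matrix (Fin M) (Fin N) ℂ)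
    {n : Fin (τ - 1) → Ω → Fin N → ℂ} {h : Ω → Fin M → ℂ}
    (hn : ∀ i, AEMeasurable (n i) P) (hh : AEMeasurable h P) :
    AEMeasurable
      (fun ω s => obsH1 q α U h n s.1 ω s.2 : Ω → Fin (τ - 1) × Fin N → ℂ) P := by
  refine aemeasurable_pi_lambda _ fun s => ?_
  have hh' : ∀ m, AEMeasurable (fun ω => h ω m) P := fun m =>
    (measurable_pi_apply m).comp_aemeasurable hh
  have hn' : AEMeasurable (fun ω => n s.1 ω s.2) P :=
    (measurable_pi_apply s.2).comp_aemeasurable (hn s.1)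
  simp only [obsH1, mulVec, dotProduct, Pi.add_apply, Pi.smul_apply, Pi.star_apply]
  fun_prop

lemma integral_mul_prod_of_indep {Ω : Type*} [MeasurableSpace Ω] {P : Measure Ω}
    [IsProbabilityMeasure P] {E F : Type*} [MeasurableSpace E] [MeasurableSpace F] {k : ℕ}
    {h : Ω → E} {n : Fin k → Ω → F} (hh : AEMeasurable h P) (hn : ∀ i, AEMeasurable (n i) P)
    (hn_indep : iIndepFun n P) (hh_indep : IndepFun h (fun ω i => n i ω) P)
    {A : E → ℂ} {B : Fin k → F → ℂ} (hA : Measurable A) (hB : ∀ i, Measurable (B i)) :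
    ∫ ω, A (h ω) * ∏ i, B i (n i ω) ∂P = (∫ ω, A (h ω) ∂P) * ∏ i, ∫ ω, B i (n i ω) ∂P := by
  have hG : Measurable fun x : Fin k → F => ∏ i, B i (x i) :=
    Finset.measurable_prod _ fun i _ => (hB i).comp (measurable_pi_apply i)
  rw [← hn_indep.integral_fun_prod_comp hn fun i => (hB i).aestronglyMeasurable]
  exact hh_indep.integral_fun_comp_mul_comp (g := fun x : Fin k → F => ∏ i, B i (x i)) hh
    (aemeasurable_pi_lambda _ hn) hA.aestronglyMeasurable hG.aestronglyMeasurable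

/-- With jamming, the stacked observation vector is `CN(0, Cᴴ R* C + σ² I)`. -/
lemma hasLaw_stacked_obsH1 {Ω : Type*} [MeasurableSpace Ω] {P : Measure Ω}
    [IsProbabilityMeasure P] (σ q : ℝ) (α : Fin (τ - 1) → ℂ) (U : Matrix (Fin M) (Fin N) ℂ)
    {R : Matrix (Fin M) (Fin M) ℂ} (hR : R.PosSemidef)
    {n : Fin (τ - 1) → Ω → Fin N → ℂ} {h : Ω → Fin M → ℂ}
    (hn : ∀ i, HasLaw (n i)
      (complexGaussian 0 (((σ ^ 2 : ℝ) : ℂ) • (1 : Matrix (Fin N) (Fin N) ℂ))) P)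
    (hn_indep : iIndepFun n P) (hh : HasLaw h (complexGaussian 0 R) P)
    (hh_indep : IndepFun h (fun ω i => n i ω) P) :
    HasLaw (fun ω s => obsH1 q α U h n s.1 ω s.2 : Ω → Fin (τ - 1) × Fin N → ℂ)
      (complexGaussian 0 (obsCov σ q α U R)) P := by
  have hnm : ∀ i, AEMeasurable (n i) P := fun i => (hn i).aemeasurable
  have hhm : AEMeasurable h P := hh.aemeasurable
  have hm := aemeasurable_stacked_obsH1 q α U hnm hhm
  refine ⟨hm, ?_⟩
  have : IsProbabilityMeasure (P.map
      (fun ω s => obsH1 q α U h n s.1 ω s.2 : Ω → Fin (τ - 1) × Fin N → ℂ)) :=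
    Measure.isProbabilityMeasure_map hm
  refine ext_of_integral_exp_dotProduct fun t => ?_
  rw [charFun_complexGaussian (posSemidef_obsCov σ q α U hR), integral_map hm
    (continuous_exp_re_dotProduct _).aestronglyMeasurable]
  set p := jammingMatrix q α U *ᵥ t with hp
  have hexp : ∀ ω, Complex.exp ((star t ⬝ᵥ fun s => obsH1 q α U h n s.1 ω s.2).re * Complex.I) =
      Complex.exp ((star (star p) ⬝ᵥ h ω).re * Complex.I) *
        ∏ i, Complex.exp ((star (fun k => t (i, k)) ⬝ᵥ n i ω).re * Complex.I) := by
    intro ω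
    rw [re_dotProduct_obsH1, ← Complex.exp_sum, ← Complex.exp_add]
    push_cast
    rw [add_mul, Finset.sum_mul]
  simp only [hexp]
  rw [integral_mul_prod_of_indep
    (A := fun x => Complex.exp ((star (star p) ⬝ᵥ x).re * Complex.I))
    (B := fun i x => Complex.exp ((star (fun k => t (i, k)) ⬝ᵥ x).re * Complex.I))
    hhm hnm hn_indep hh_indep (continuous_exp_re_dotProduct _).measurable
    fun i => (continuous_exp_re_dotProduct _).measurable]
  have h1 : ∫ ω, Complex.exp ((star (star p) ⬝ᵥ h ω).re * Complex.I) ∂P =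
      Complex.exp (-((star p ⬝ᵥ R.map star *ᵥ p).re / 4 : ℝ)) := by
    rw [← integral_map (f := fun x : Fin M → ℂ =>
      Complex.exp ((star (star p) ⬝ᵥ x).re * Complex.I)) hhm (continuous_exp_re_dotProduct _).aestronglyMeasurable,
      hh.map_eq, charFun_complexGaussian hR]
    have e : R.map star *ᵥ p = star (R *ᵥ star p) := by
      ext m; simp [mulVec, dotProduct]
    rw [e, star_dotProduct_star, star_star, dotProduct_comm, Complex.star_def, Complex.conj_re]
  have h2 : ∀ i, ∫ ω, Complex.exp ((star (fun k => t (i, k)) ⬝ᵥ n i ω).re * Complex.I) ∂P =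
      Complex.exp (-((σ ^ 2 * ∑ k, ‖t (i, k)‖ ^ 2) / 4 : ℝ)) := by
    intro i
    rw [← integral_map (f := fun x : Fin N → ℂ =>
      Complex.exp ((star (fun k => t (i, k)) ⬝ᵥ x).re * Complex.I)) (hnm i)
      (continuous_exp_re_dotProduct _).aestronglyMeasurable,
      (hn i).map_eq, charFun_complexGaussian (posSemidef_sq_smul_one σ)]
    rw [smul_mulVec, one_mulVec, dotProduct_smul, smul_eq_mul, Complex.re_ofReal_mul,
      ← norm_sq_toLp, EuclideanSpace.norm_sq_eq]
  rw [h1, Finset.prod_congr rfl fun i _ => h2 i, ← Complex.exp_sum, ← Complex.exp_add]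
  congr 1
  have h3 : (star t ⬝ᵥ obsCov σ q α U R *ᵥ t).re =
      (star p ⬝ᵥ R.map star *ᵥ p).re + ∑ i, σ ^ 2 * ∑ k, ‖t (i, k)‖ ^ 2 := by
    rw [obsCov, add_mulVec, dotProduct_add, Complex.add_re, ← mulVec_mulVec, ← mulVec_mulVec,
      ← star_mulVec_dotProduct, smul_mulVec, one_mulVec, dotProduct_smul, smul_eq_mul,
      Complex.re_ofReal_mul, ← norm_sq_toLp, EuclideanSpace.norm_sq_eq, Fintype.sum_prod_type,
      Finset.mul_sum]
  rw [h3, add_div, Finset.sum_div]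
  push_cast
  rw [neg_add, Finset.sum_neg_distrib]

/-! ### The statistic as a quadratic form -/

/-- The statistic is `yᴴ (I ⊗ K) y` for the stacked observation vector `y`. -/
lemma statistic_eq_quadForm {Ω : Type*} {K : Matrix (Fin N) (Fin N) ℂ}
    {V : Matrix (Fin N) (Fin N) ℂ} {lam : Fin N → ℝ}
    (hK : K = V * diagonal (fun j => (lam j : ℂ)) * Vᴴ)
    (y : Fin (τ - 1) → Ω → Fin N → ℂ) (ω : Ω) :
    statistic lam V y ω = (star (fun s : Fin (τ - 1) × Fin N => y s.1 ω s.2) ⬝ᵥ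
      ((1 : Matrix (Fin (τ - 1)) (Fin (τ - 1)) ℂ) ⊗ₖ K) *ᵥ fun s => y s.1 ω s.2).re := by
  have h : star (fun s : Fin (τ - 1) × Fin N => y s.1 ω s.2) ⬝ᵥ
      ((1 : Matrix (Fin (τ - 1)) (Fin (τ - 1)) ℂ) ⊗ₖ K) *ᵥ (fun s => y s.1 ω s.2) =
      ∑ i, star (y i ω) ⬝ᵥ K *ᵥ y i ω := by
    simp only [dotProduct, mulVec, Fintype.sum_prod_type, kroneckerMap_apply, one_apply, ite_mul,
      one_mul, zero_mul, Pi.star_apply]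
    refine Finset.sum_congr rfl fun i _ => Finset.sum_congr rfl fun k _ => ?_
    congr 1
    rw [Finset.sum_comm]
    simp
  rw [h, Complex.re_sum, statistic]
  refine Finset.sum_congr rfl fun i _ => ?_
  rw [hK, re_quadForm_diagonalization]
  refine Finset.sum_congr rfl fun k _ => ?_
  have : (Vᴴ *ᵥ y i ω) k = star (star (y i ω) ⬝ᵥ V.col k) := by
    simp [mulVec, dotProduct, mul_comm]
  rw [this, norm_star]

lemma aemeasurable_statistic {Ω : Type*} [MeasurableSpace Ω] {P : Measure Ω}
    (lam : Fin N → ℝ) (V : Matrix (Fin N) (Fin N) ℂ) {y : Fin (τ - 1) → Ω → Fin N → ℂ}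
    (hy : AEMeasurable (fun ω s => y s.1 ω s.2 : Ω → Fin (τ - 1) × Fin N → ℂ) P) :
    AEMeasurable (statistic lam V y) P := by
  have hy' : ∀ i k, AEMeasurable (fun ω => y i ω k) P := fun i k =>
    (measurable_pi_apply (i, k)).comp_aemeasurable hy
  unfold statistic dotProduct
  simp only [Pi.star_apply]
  fun_prop

/-- The Laplace transform of the statistic only depends on the eigenvalues of `B`, computed from the
covariance matrix `S` of the stacked observation vector. -/
lemma laplace_statistic {Ω : Type*} [MeasurableSpace Ω] {P : Measure Ω}
    {K : Matrix (Fin N) (Fin N) ℂ} {V : Matrix (Fin N) (Fin N) ℂ} {lam : Fin N → ℝ}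
    (hK : K = V * diagonal (fun j => (lam j : ℂ)) * Vᴴ)
    {S : Matrix (Fin (τ - 1) × Fin N) (Fin (τ - 1) × Fin N) ℂ}
    {y : Fin (τ - 1) → Ω → Fin N → ℂ}
    (hy : HasLaw (fun ω s => y s.1 ω s.2 : Ω → Fin (τ - 1) × Fin N → ℂ) (complexGaussian 0 S) P)
    (hB : (matB S K).PosSemidef) {s : ℝ} (hs : 0 ≤ s) :
    ∫ ω, Real.exp (-(s * statistic lam V y ω)) ∂P =
      ∏ k, (1 + s * hB.isHermitian.eigenvalues k)⁻¹ := by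
  simp_rw [statistic_eq_quadForm hK]
  rw [← integral_map (f := fun x : Fin (τ - 1) × Fin N → ℂ => Real.exp (-(s * (star x ⬝ᵥ
    ((1 : Matrix (Fin (τ - 1)) (Fin (τ - 1)) ℂ) ⊗ₖ K) *ᵥ x).re))) hy.aemeasurable
    (by unfold dotProduct mulVec dotProduct; fun_prop), hy.map_eq]
  exact laplace_quadForm_complexGaussian hB hs

lemma stackedCov_eq {Ω : Type*} [MeasurableSpace Ω] {P : Measure Ω}
    {S : Matrix (Fin (τ - 1) × Fin N) (Fin (τ - 1) × Fin N) ℂ} (hS : S.PosSemidef)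
    {y : Fin (τ - 1) → Ω → Fin N → ℂ}
    (hy : HasLaw (fun ω s => y s.1 ω s.2 : Ω → Fin (τ - 1) × Fin N → ℂ)
      (complexGaussian 0 S) P) :
    stackedCov P y = S := by
  ext a b
  rw [stackedCov, of_apply, ← integral_mul_star_complexGaussian hS, ← hy.map_eq,
    integral_map hy.aemeasurable (by fun_prop)]

/-! ### Positive eigenvalues -/

/-- The product `∏ k, (1 + s μ_k)` in the Laplace transform of the statistic as a determinant, a form
in which it can be compared for different matrices. -/
lemma det_one_add_smul_diagonalization {ι : Type*} [Fintype ι] [DecidableEq ι]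
    {B W : Matrix ι ι ℂ} {μ : ι → ℝ} (hW : Wᴴ * W = 1)
    (hB : B = W * diagonal (fun k => (μ k : ℂ)) * Wᴴ) (s : ℝ) :
    (1 + (s : ℂ) • B).det = ((∏ k, (1 + s * μ k) : ℝ) : ℂ) := by
  rw [hB, Matrix.mul_assoc, ← mul_smul_comm, det_one_add_mul_comm, smul_mul_assoc,
    Matrix.mul_assoc, hW, Matrix.mul_one, ← diagonal_smul, ← diagonal_one, diagonal_add,
    det_diagonal]
  push_cast
  rfl

lemma prod_one_add_eigenvalues {ι : Type*} [Fintype ι] [DecidableEq ι] {B : Matrix ι ι ℂ}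
    (hB : B.IsHermitian) (s : ℝ) :
    ((∏ k, (1 + s * hB.eigenvalues k) : ℝ) : ℂ) = (1 + (s : ℂ) • B).det :=
  (det_one_add_smul_diagonalization (Unitary.coe_star_mul_self hB.eigenvectorUnitary)
    hB.spectral_theorem s).symm

/-- The positive eigenvalues of a positive semidefinite matrix `B`, enumerated by `Fin B.rank`. -/
lemma exists_isPosEigenvalues {ι : Type*} [Fintype ι] [DecidableEq ι] {B : Matrix ι ι ℂ}
    (hB : B.PosSemidef) :
    ∃ ε : Fin B.rank → ℝ, IsPosEigenvalues B ε ∧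
      ∀ s : ℝ, ∏ k, (1 + s * hB.isHermitian.eigenvalues k) = ∏ j, (1 + s * ε j) := by
  set μ := hB.isHermitian.eigenvalues with hμ
  have hμ0 : ∀ k, 0 ≤ μ k := hB.eigenvalues_nonneg
  let e : {k // μ k ≠ 0} ≃ Fin B.rank :=
    Fintype.equivFinOfCardEq hB.isHermitian.rank_eq_card_non_zero_eigs.symm
  refine ⟨fun j => μ (e.symm j), ⟨fun j => (hμ0 _).lt_of_ne' (e.symm j).2, fun x hx => ?_⟩,
    fun s => ?_⟩
  · have h1 : B.charpoly.rootMultiplicity (x : ℂ) =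
        (Finset.univ.filter fun k => μ k = x).card := by
      rw [← Polynomial.count_roots, hB.isHermitian.roots_charpoly_eq_eigenvalues,
        Multiset.count_map, Finset.card_def, Finset.filter_val]
      congr 2
      ext k
      simp [hμ, eq_comm]
    rw [h1]
    symm
    refine Finset.card_bij (fun j _ => (e.symm j : ι)) (fun j hj => by simpa using hj)
      (fun i _ j _ hij => e.symm.injective (Subtype.ext hij)) fun k hk => ?_
    have hkx : μ k = x := by simpa using hk
    have hk0 : μ k ≠ 0 := hkx ▸ hx.ne'
    exact ⟨e ⟨k, hk0⟩, by simpa using hkx, by simp⟩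
  · rw [e.symm.prod_comp (fun k => 1 + s * μ k)]
    rw [← Finset.prod_filter_of_ne (p := fun k => μ k ≠ 0)]
    · exact Finset.prod_subtype _ (by simp) _
    · exact fun k _ hk h0 => hk (by rw [h0, mul_zero, add_zero])

lemma rank_pos_of_ne_zero {m n : Type*} [Fintype m] [Fintype n] [DecidableEq n]
    {A : Matrix m n ℂ} (hA : A ≠ 0) : 0 < A.rank := by
  rw [Nat.pos_iff_ne_zero]
  intro h
  rw [Matrix.rank, Submodule.finrank_eq_zero, LinearMap.range_eq_bot] at h
  exact hA (ext_of_mulVec_single fun i => by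
    rw [zero_mulVec]
    exact LinearMap.congr_fun h (Pi.single i 1))

lemma kronecker_one_ne_zero (hτ : 2 ≤ τ) {K : Matrix (Fin N) (Fin N) ℂ} (hK : K ≠ 0) :
    (1 : Matrix (Fin (τ - 1)) (Fin (τ - 1)) ℂ) ⊗ₖ K ≠ 0 := by
  intro h
  apply hK
  ext a b
  have i : Fin (τ - 1) := ⟨0, by omega⟩
  simpa using congrFun (congrFun h (i, a)) (i, b)

/-- As `S` is invertible, `B = S^{1/2} (I ⊗ K) S^{1/2}` vanishes only if `K` does. This makes the
rank of `B` positive, so that the exponents of the gamma series are nonnegative. -/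
lemma matB_ne_zero (hτ : 2 ≤ τ) {K : Matrix (Fin N) (Fin N) ℂ} (hK : K ≠ 0)
    {S : Matrix (Fin (τ - 1) × Fin N) (Fin (τ - 1) × Fin N) ℂ} (hS : S.PosDef) :
    matB S K ≠ 0 := by
  intro h
  have hu : IsUnit S.det := (isUnit_iff_isUnit_det S).1 hS.isUnit
  have h2 : S * ((1 : Matrix (Fin (τ - 1)) (Fin (τ - 1)) ℂ) ⊗ₖ K) * S = 0 := by
    have e := congrArg (fun X => CFC.sqrt S * X * CFC.sqrt S) h
    simp only [matB, Matrix.mul_zero, Matrix.zero_mul] at e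
    conv_lhs => rw [← sqrt_mul_sqrt_of_posSemidef hS.posSemidef]
    simpa only [Matrix.mul_assoc] using e
  apply kronecker_one_ne_zero hτ hK
  have e := congrArg (fun X => S⁻¹ * X * S⁻¹) h2
  simpa only [Matrix.mul_assoc, mul_nonsing_inv _ hu, Matrix.mul_one, Matrix.mul_zero,
    Matrix.zero_mul, nonsing_inv_mul_cancel_left _ _ hu] using e

lemma posDef_obsCov {σ : ℝ} (hσ : 0 < σ) (q : ℝ) (α : Fin (τ - 1) → ℂ)
    (U : Matrix (Fin M) (Fin N) ℂ) {R : Matrix (Fin M) (Fin M) ℂ} (hR : R.PosSemidef) :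
    (obsCov σ q α U R).PosDef :=
  PosDef.posSemidef_add ((posSemidef_map_star hR).conjTranspose_mul_mul_same _)
    (PosDef.one.smul (by exact_mod_cast pow_pos hσ 2))

/-- By Sylvester's determinant identity, the square root of `S` can be avoided. -/
lemma det_one_add_smul_matB {S : Matrix (Fin (τ - 1) × Fin N) (Fin (τ - 1) × Fin N) ℂ}
    (hS : S.PosSemidef) (K : Matrix (Fin N) (Fin N) ℂ) (c : ℂ) :
    (1 + c • matB S K).det =
      (1 + c • (((1 : Matrix (Fin (τ - 1)) (Fin (τ - 1)) ℂ) ⊗ₖ K) * S)).det := by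
  rw [matB, Matrix.mul_assoc, ← mul_smul_comm, det_one_add_mul_comm, smul_mul_assoc,
    Matrix.mul_assoc, sqrt_mul_sqrt_of_posSemidef hS]

/-! ### The absence of the jammer -/

lemma obsCov_zero (σ : ℝ) (α : Fin (τ - 1) → ℂ) (U : Matrix (Fin M) (Fin N) ℂ)
    (R : Matrix (Fin M) (Fin M) ℂ) :
    obsCov σ 0 α U R = ((σ ^ 2 : ℝ) : ℂ) • 1 := by
  have : jammingMatrix 0 α U = 0 := by ext; simp [jammingMatrix]
  rw [obsCov, this, Matrix.mul_zero, zero_add]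

lemma obsH1_zero {Ω : Type*} (α : Fin (τ - 1) → ℂ) (U : Matrix (Fin M) (Fin N) ℂ)
    (h : Ω → Fin M → ℂ) (n : Fin (τ - 1) → Ω → Fin N → ℂ) : obsH1 0 α U h n = n := by
  ext; simp [obsH1]

lemma nonneg_of_diagonalization {K V : Matrix (Fin N) (Fin N) ℂ} (hK : K.PosSemidef)
    (hV : Vᴴ * V = 1) {lam : Fin N → ℝ}
    (h : K = V * diagonal (fun j => (lam j : ℂ)) * Vᴴ) (k : Fin N) : 0 ≤ lam k := by
  have h1 : Vᴴ * K * V = diagonal (fun j => (lam j : ℂ)) := by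
    rw [h, ← Matrix.mul_assoc, ← Matrix.mul_assoc, hV, Matrix.one_mul, Matrix.mul_assoc, hV,
      Matrix.mul_one]
  have h2 := hK.conjTranspose_mul_mul_same V
  rw [h1, posSemidef_diagonal_iff] at h2
  exact_mod_cast h2 k

lemma rank_eq_card_of_diagonalization {K V : Matrix (Fin N) (Fin N) ℂ} (hV : Vᴴ * V = 1)
    {lam : Fin N → ℝ} (h : K = V * diagonal (fun j => (lam j : ℂ)) * Vᴴ) :
    K.rank = (Finset.univ.filter fun k => lam k ≠ 0).card := by
  have hu : IsUnit V.det := isUnit_det_of_left_inverse hV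
  have hu' : IsUnit Vᴴ.det := isUnit_det_of_right_inverse hV
  rw [h, rank_mul_eq_left_of_isUnit_det _ _ hu', rank_mul_eq_right_of_isUnit_det _ _ hu,
    rank_diagonal, Fintype.card_subtype]
  simp

/-- The nonzero terms of a nonincreasing nonnegative sequence come first. -/
lemma ne_zero_iff_lt_card {lam : Fin N → ℝ} (hanti : Antitone lam) (h0 : ∀ k, 0 ≤ lam k)
    (k : Fin N) : lam k ≠ 0 ↔ (k : ℕ) < (Finset.univ.filter fun k => lam k ≠ 0).card := by
  constructor
  · intro hk
    have hsub : Finset.Iic k ⊆ Finset.univ.filter fun k => lam k ≠ 0 := fun j hj => by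
      have := hanti (Finset.mem_Iic.1 hj)
      have := (h0 k).lt_of_ne' hk
      simp only [Finset.mem_filter, Finset.mem_univ, true_and]
      linarith
    have := Finset.card_le_card hsub
    rw [Fin.card_Iic] at this
    omega
  · intro hk hk0
    have hsub : (Finset.univ.filter fun k => lam k ≠ 0) ⊆ Finset.Iio k := fun j hj => by
      rw [Finset.mem_Iio]
      by_contra hjk
      have h1 := hanti (not_lt.1 hjk)
      have h2 := h0 j
      exact (Finset.mem_filter.1 hj).2 (by linarith)
    have := Finset.card_le_card hsub
    rw [Fin.card_Iio] at this
    omega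

lemma prod_castLE {r : ℕ} (hr : r ≤ N) {f : Fin N → ℝ} (hf : ∀ k : Fin N, r ≤ k → f k = 1) :
    ∏ j : Fin r, f (Fin.castLE hr j) = ∏ k, f k := by
  refine (Finset.prod_map Finset.univ (Fin.castLEEmb hr) f).symm.trans ?_
  refine Finset.prod_subset (Finset.subset_univ _) fun k _ hk => hf k ?_
  by_contra hlt
  exact hk (Finset.mem_map.2 ⟨⟨k, by omega⟩, Finset.mem_univ _, by ext; rfl⟩)

/-- Without jamming, `S = σ² I`, and the determinant `det (1 + s B)` factors over the `τ - 1`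
pilots. -/
lemma prod_one_add_eigenvalues_matB_smul_one (σ : ℝ) {K V : Matrix (Fin N) (Fin N) ℂ}
    (hV : Vᴴ * V = 1) {lam : Fin N → ℝ}
    (hK : K = V * diagonal (fun j => (lam j : ℂ)) * Vᴴ)
    (hB : (matB (τ := τ) (((σ ^ 2 : ℝ) : ℂ) • 1) K).IsHermitian) (s : ℝ) :
    ∏ k, (1 + s * hB.eigenvalues k) = ∏ k, (1 + s * (lam k * σ ^ 2)) ^ (τ - 1) := by
  have h : (1 : Matrix (Fin (τ - 1) × Fin N) (Fin (τ - 1) × Fin N) ℂ) +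
      (s : ℂ) • (((1 : Matrix (Fin (τ - 1)) (Fin (τ - 1)) ℂ) ⊗ₖ K) * ((σ ^ 2 : ℝ) : ℂ) • 1) =
      (1 : Matrix (Fin (τ - 1)) (Fin (τ - 1)) ℂ) ⊗ₖ (1 + ((s * σ ^ 2 : ℝ) : ℂ) • K) := by
    rw [kronecker_add, one_kronecker_one, kronecker_smul, mul_smul_comm, Matrix.mul_one, smul_smul,
      Complex.ofReal_mul]
  have h2 := prod_one_add_eigenvalues hB s
  rw [det_one_add_smul_matB (posSemidef_sq_smul_one σ), h, det_kronecker, det_one, one_pow,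
    one_mul, Fintype.card_fin, det_one_add_smul_diagonalization hV hK, ← Complex.ofReal_pow] at h2
  rw [Complex.ofReal_injective h2, ← Finset.prod_pow]
  refine Finset.prod_congr rfl fun k _ => ?_
  ring

end

end LMPT

theorem theorem1 {Ω : Type*} [MeasurableSpace Ω] (P : Measure Ω) [IsProbabilityMeasure P]
    (τ M N : ℕ) (hτ : 2 ≤ τ) (σ q : ℝ) (hσ : 0 < σ) (hq : 0 ≤ q)
    -- channel covariance, beamforming matrix, and (fixed) pilot inner products of the jammer
    (R : Matrix (Fin M) (Fin M) ℂ) (hR : R.PosSemidef)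
    (U : Matrix (Fin M) (Fin N) ℂ) (α : Fin (τ - 1) → ℂ)
    (hU : LMPT.beamCov U R ≠ 0)
    -- the noise vectors and the jamming channel
    (n : Fin (τ - 1) → Ω → Fin N → ℂ) (h : Ω → Fin M → ℂ)
    (hn : ∀ i, HasLaw (n i)
      (LMPT.complexGaussian 0 (((σ ^ 2 : ℝ) : ℂ) • (1 : Matrix (Fin N) (Fin N) ℂ))) P)
    (hn_indep : iIndepFun n P)
    (hh : HasLaw h (LMPT.complexGaussian 0 R) P)
    (hh_indep : IndepFun h (fun ω i => n i ω) P)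
    -- eigenvalue decomposition of the beam-domain covariance matrix
    (V : Matrix (Fin N) (Fin N) ℂ) (hV : V ∈ Matrix.unitaryGroup (Fin N) ℂ)
    (lam : Fin N → ℝ) (hlam : Antitone lam)
    (hEVD : LMPT.beamCov U R = V * Matrix.diagonal (fun j => (lam j : ℂ)) * Vᴴ) :
    -- absence of the jammer
    (let θ : Fin (LMPT.beamCov U R).rank → ℝ :=
        fun j => lam (Fin.castLE (LMPT.beamCov U R).rank_le_width j) * σ ^ 2;
      (∀ x : ℝ, 0 < x → Summable (LMPT.term (τ - 1) θ x)) ∧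
        LMPT.IsPDF P (LMPT.statistic lam V n) (LMPT.seriesPDF (τ - 1) θ)) ∧
    -- presence of the jammer
    (let y := LMPT.obsH1 q α U h n;
      let B := LMPT.matB (LMPT.stackedCov P y) (LMPT.beamCov U R);
      ∃ ε : Fin B.rank → ℝ, LMPT.IsPosEigenvalues B ε ∧
        (∀ x : ℝ, 0 < x → Summable (LMPT.term 1 ε x)) ∧
        LMPT.IsPDF P (LMPT.statistic lam V y) (LMPT.seriesPDF 1 ε)) := by
  have hVV : Vᴴ * V = 1 := (Matrix.mem_unitaryGroup_iff').1 hV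
  have hK := LMPT.posSemidef_beamCov U hR
  have hlaw := fun q => LMPT.hasLaw_stacked_obsH1 σ q α U hR hn hn_indep hh hh_indep
  have hBpsd : ∀ S, (LMPT.matB (τ := τ) S (LMPT.beamCov U R)).PosSemidef := fun S =>
    LMPT.posSemidef_sqrt_mul_mul_sqrt S (PosSemidef.one.kronecker hK)
  refine ⟨?_, ?_⟩
  · intro θ
    have hlam0 := LMPT.nonneg_of_diagonalization hK hVV hEVD
    have hrank := LMPT.rank_eq_card_of_diagonalization hVV hEVD
    have hne := LMPT.ne_zero_iff_lt_card hlam hlam0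
    rw [← hrank] at hne
    have hθ : ∀ j, 0 < θ j := fun j =>
      mul_pos ((hlam0 _).lt_of_ne' ((hne _).2 (by simp))) (by positivity)
    have hpos : 0 < (τ - 1) * (LMPT.beamCov U R).rank :=
      Nat.mul_pos (by omega) (LMPT.rank_pos_of_ne_zero hU)
    -- the absence of the jammer is the case `q = 0`
    have hlaw0 := hlaw 0
    rw [LMPT.obsH1_zero, LMPT.obsCov_zero] at hlaw0
    refine ⟨fun x hx => LMPT.summable_term hpos hθ hx.le,
      LMPT.isPDF_seriesPDF_of_laplace (LMPT.aemeasurable_statistic lam V hlaw0.aemeasurable) hpos hθ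
        fun s hs => ?_⟩
    rw [LMPT.laplace_statistic hEVD hlaw0 (hBpsd _) hs, Finset.prod_inv_distrib,
      LMPT.prod_one_add_eigenvalues_matB_smul_one σ hVV hEVD]
    simp_rw [inv_pow]
    rw [Finset.prod_inv_distrib]
    congr 1
    refine (LMPT.prod_castLE (f := fun k => (1 + s * (lam k * σ ^ 2)) ^ (τ - 1))
      (LMPT.beamCov U R).rank_le_width fun k hk => ?_).symm
    have : lam k = 0 := not_not.1 fun h0 => absurd ((hne k).1 h0) (by omega)
    rw [this, zero_mul, mul_zero, add_zero, one_pow]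
  · have hS := LMPT.posDef_obsCov hσ q α U hR
    intro y
    rw [LMPT.stackedCov_eq hS.posSemidef (hlaw q)]
    intro B
    obtain ⟨ε, hε, hprod⟩ := LMPT.exists_isPosEigenvalues (hBpsd (LMPT.obsCov σ q α U R))
    have hpos : 0 < 1 * B.rank := by
      rw [one_mul]; exact LMPT.rank_pos_of_ne_zero (LMPT.matB_ne_zero hτ hU hS)
    refine ⟨ε, hε, fun x hx => LMPT.summable_term hpos hε.1 hx.le,
      LMPT.isPDF_seriesPDF_of_laplace
        (LMPT.aemeasurable_statistic lam V (hlaw q).aemeasurable) hpos hε.1 fun s hs => ?_⟩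
    rw [LMPT.laplace_statistic hEVD (hlaw q) (hBpsd _) hs, Finset.prod_inv_distrib, hprod]
    simp only [pow_one, Finset.prod_inv_distrib]
    rfl
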